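/- Let $q\in\mathbb{C}$ with $0<|q|<1$, and let $$\theta(z)=(e^{z/2}-e^{-z/2})\prod_{k\ge 1}\frac{(1-q^ke^{z})(1-q^ke^{-z})}{(1-q^k)^2}$$ be the odd Jacobi theta function with $\theta'(0)=1$. For $n\ge 1$ and points $P_i,Q_j$ put $$\Theta_{2n}(P,Q)=\frac{\prod_{i<j}\theta(P_i-P_j)\,\theta(Q_i-Q_j)}{\prod_i\theta(P_i-Q_i)\prod_{i<j}\theta(P_i-Q_j)\,\theta(Q_i-P_j)} .$$ Write $u_k=e^{z_k}$, $v_j=e^{w_j}$, and take $P_i=z_i+w_i$, $Q_j=w_j$. Then $\theta(z_1+\cdots+z_n)\,\Theta_{2n}$ is a well-defined function of $u,v\in(\mathbb{C}^*)^n$. Let $\Omega_{\mathrm{GW}}$ be the set of $(u,v)$ with $$|u_1v_1|>|v_1|>|u_2v_2|>|v_2|>\cdots>|u_nv_n|>|v_n|>|q|\,|u_1v_1| ,$$ and let $T_n^{\Omega_{\mathrm{GW}}}(u_1,\dots,u_n)$ be the meromorphic continuation to $u\in(\mathbb{C}^*)^n$ of the ordered $A$-cycle integral $$\Big(\frac{1}{2\pi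 \mathbf{i}}\Big)^{n}\int_{|v_j|=r_j,\ 1\le j\le n}\frac{dv_1}{v_1}\cdots\frac{dv_n}{v_n}\;\theta(z_1+\cdots+z_n)\,\Theta_{2n},$$ where the $r_j>0$ are such that the torus $|v_j|=r_j$ lies in $\Omega_{\mathrm{GW}}$. That is, $T_n^{\Omega_{\mathrm{GW}}}=N/D$ with $N,D$ holomorphic on $(\mathbb{C}^*)^n$, $D\not\equiv 0$, and $N=D\cdot(\text{integral})$ for all admissible $u$ and $r$. For every $n\ge 1$ this meromorphic continuation exists, and $$T_n^{\Omega_{\mathrm{GW}}}(qu_1,u_2,\dots,u_n)=T_n^{\Omega_{\mathrm{GW}}}(u_1,\dots,u_n)+\sum_{\emptyset\ne I\subseteq\{2,\dots,n\}}(-1)^{|I|}\,T_{n-|I|}^{\Omega_{\mathrm{GW}}}\big(u_1u_I,\dots,\check{u}_i,\dots\big)$$ as meromorphic functions, i.e. at every $u\in(\mathbb{C}^*)^n$ at which all the terms are holomorphic. Here $u_I=\prod_{i\in I}u_i$, and the arguments of the last term are $u_1u_I$ followed by the $u_k$ with $k\in\{2,\dots,n\}\setminus I$ in their order. -/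

import Mathlib

namespace EllipticGW

/-- The odd Jacobi theta function `θ(z)` with nome `q`, `0 < |q| < 1`, normalized by `θ'(0) = 1`,
in the additive coordinate `z`, given by its product expansion
`(e^{z/2} - e^{-z/2}) ∏_{k ≥ 1} (1 - q^k e^z)(1 - q^k e^{-z}) / (1 - q^k)^2`. -/
noncomputable def theta (q z : ℂ) : ℂ :=
  (Complex.exp (z / 2) - Complex.exp (-z / 2)) *
    ∏' k : ℕ, ((1 - q ^ (k + 1) * Complex.exp z) * (1 - q ^ (k + 1) * Complex.exp (-z)) /
      (1 - q ^ (k + 1)) ^ 2)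

/-- The product `Θ_{2n}(P, Q)` of prime forms `E(P, Q) = θ(P - Q)`, in additive coordinates. -/
noncomputable def ThetaTwo (q : ℂ) {n : ℕ} (P Q : Fin n → ℂ) : ℂ :=
  (∏ i, ∏ j ∈ Finset.Ioi i, theta q (P i - P j) * theta q (Q i - Q j)) /
    ((∏ i, theta q (P i - Q i)) *
      ∏ i, ∏ j ∈ Finset.Ioi i, theta q (P i - Q j) * theta q (Q i - P j))

/-- The function `θ(∏ u_k) Θ_{2n}` in the multiplicative coordinates `u, v`, where the points
`P_i, Q_j` are `u_i v_i, v_j`. Each sign produced by `θ(z + 2πi) = -θ(z)` occurs an even number of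
times when one `log u_i` or one `log v_j` is changed by `2πi`, so the choice of the logarithms
does not matter. -/
noncomputable def integrand (q : ℂ) {n : ℕ} (u v : Fin n → ℂ) : ℂ :=
  theta q (∑ k, Complex.log (u k)) *
    ThetaTwo q (fun i => Complex.log (u i) + Complex.log (v i)) (fun j => Complex.log (v j))

/-- The ordering `|u₁v₁| > |v₁| > |u₂v₂| > |v₂| > ⋯ > |uₙvₙ| > |vₙ|`, with `r_j = |v_j|`, where all
the points lie in one annulus of the elliptic curve `ℂˣ / q^ℤ`, that is, the quotient of any two
of the absolute values is larger than `|q|`. -/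
def OmegaGW (q : ℂ) {n : ℕ} (u : Fin n → ℂ) (r : Fin n → ℝ) : Prop :=
  (∀ i, 0 < r i) ∧ (∀ i, r i < ‖u i‖ * r i) ∧ (∀ i j, i < j → ‖u j‖ * r j < r i) ∧
    ∀ i j, ‖q‖ * (‖u i‖ * r i) < r j

/-- The ordered `A`-cycle integral
`(1 / 2πi)^n ∫ dv₁/v₁ ⋯ dvₙ/vₙ θ(∏ u_k) Θ_{2n}` over the torus `|v_j| = r_j`. -/
noncomputable def cycleIntegral (q : ℂ) {n : ℕ} (u : Fin n → ℂ) (r : Fin n → ℝ) : ℂ :=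
  (1 / (2 * Real.pi * Complex.I)) ^ n *
    ∯ v in T(0, r), (∏ j, (v j)⁻¹) * integrand q u v

/-- The complex torus `(ℂˣ)^n`. -/
def cTorus (n : ℕ) : Set (Fin n → ℂ) := {u | ∀ i, u i ≠ 0}

/-- The quotient `N / D` of two holomorphic functions on `(ℂˣ)^n`, with `D` not identically zero,
is a meromorphic function that continues the integral over the cycle of the ordering `Ω_GW`. -/
structure IsContinuation (q : ℂ) (n : ℕ) (N D : (Fin n → ℂ) → ℂ) : Prop where
  num : AnalyticOnNhd ℂ N (cTorus n)
  den : AnalyticOnNhd ℂ D (cTorus n)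
  den_ne : ∃ u ∈ cTorus n, D u ≠ 0
  continues : ∀ u r, OmegaGW q u r → N u = D u * cycleIntegral q u r

/-- The meromorphic continuation of the integral is holomorphic at the point `u` of `(ℂˣ)^n`. -/
def RegularAt (q : ℂ) (n : ℕ) (u : Fin n → ℂ) : Prop :=
  u ∈ cTorus n ∧ ∃ N D, IsContinuation q n N D ∧ D u ≠ 0

open Classical in
/-- The value of `T_n^{Ω_GW}`, the meromorphic continuation of the integral, at a point `u` where
it is holomorphic. (The value is `0` elsewhere.) For `0 < |q| < 1` and `n ≥ 1` it does not depend
on the choice of `N` and `D`, because `(ℂˣ)^n` is connected and the region `Ω_GW` is open and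
not empty. -/
noncomputable def TGW (q : ℂ) (n : ℕ) (u : Fin n → ℂ) : ℂ :=
  if h : ∃ p : ((Fin n → ℂ) → ℂ) × ((Fin n → ℂ) → ℂ),
      u ∈ cTorus n ∧ IsContinuation q n p.1 p.2 ∧ p.2 u ≠ 0 then
    h.choose.1 u / h.choose.2 u
  else 0

/-- The index `1` of `[n]`. -/
def first {n : ℕ} (hn : 1 ≤ n) : Fin n := ⟨0, hn⟩

theorem card_compl_fin {n : ℕ} (I : Finset (Fin n)) : (Iᶜ).card = n - I.card := by
  rw [Finset.card_compl, Fintype.card_fin]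

/-- The `(n - |I|)`-tuple `(u₁ u_I, …, ǔ_i, …)`: the entries `u_i`, `i ∈ I`, are omitted, the others
stay in their order, and `u₁` is replaced by `u₁ ∏_{i ∈ I} u_i`. -/
def merge {n : ℕ} (hn : 1 ≤ n) (u : Fin n → ℂ) (I : Finset (Fin n)) : Fin (n - I.card) → ℂ :=
  fun k => Function.update u (first hn) (u (first hn) * ∏ i ∈ I, u i)
    ((Iᶜ).orderEmbOfFin (card_compl_fin I) k)

/-- The nonempty subsets `I` of `[n] ∖ {1}`. -/
def subsetsAvoidingFirst {n : ℕ} (hn : 1 ≤ n) : Finset (Finset (Fin n)) :=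
  {I | I.Nonempty ∧ first hn ∉ I}

end EllipticGW

/-! Introduce an auxiliary parameter `t` with |q| < |e^t| < 1, and let κ(U, t) = θ(z+t)/(θ(z)θ(t)),
U = e^z, be the Kronecker function (`kron`). Frobenius' determinant formula (`det_theta`) turns
κ(∏u_k, t) · θ(∑z_k) Θ_{2n} into det κ(u_i v_i / v_j, t). It follows from the three-term theta
relation by Gaussian elimination.

On the torus of the ordering every entry has an explicit Laurent series: its coefficients are p(m) =
-x/(1-x), x = e^t q^m, on and above the diagonal, and p(m) - 1 below it. Integration over v keeps
only the terms in which the exponents m_i are constant on the cycles of the permutation. The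
coefficient of ∏ u_i^{m_i} is then a determinant that collapses to the product of p(k) over the
distinct values k of m (`det_levels`, `hasSum_torusMean_det`).

The same series is a sum over set partitions of the indices: a block B contributes the (|B|-1)-st
derivative in t of κ(∏_{i∈B} u_i, t) (`moment`, `hasSum_moment`). The link is the recursion
satisfied by the t-derivatives of p (`iteratedDeriv_kronCoeff`). Hence T_n = `moment` / κ(∏u_k, t),
an expression in `phi` and its derivatives, which gives the continuation.

Finally, κ(qU, t) = e^{-t} κ(U, t). Differentiating k times in t produces e^{-t} ∑_j C(k,j)(-1)^j
κ^{(k-j)}(U, t), and C(k,j) counts the j-element subsets I of a block that are absorbed into u_1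
(`moment_update`). The factor e^{-t} cancels against the one of κ(∏u_k, t). This proves the identity
off the zeros of one denominator, and continuity extends it to all points where the terms are
holomorphic. -/

namespace EllipticGW

/-! ### The theta function in the multiplicative coordinate. -/

section

open Complex Filter Topology

/-- The Euler product `∏_{k ≥ 1} (1 - q^k x)`. -/
noncomputable def eulerProd (q x : ℂ) : ℂ := ∏' k : ℕ, (1 - q ^ (k + 1) * x)

/-- The theta function in the multiplicative coordinate `x = e^z`, without the factor
`e^{-z/2}`. -/
noncomputable def phi (q x : ℂ) : ℂ :=
  (x - 1) * eulerProd q x * eulerProd q x⁻¹ / eulerProd q 1 ^ 2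

variable {q : ℂ}

theorem summable_norm_pow_mul (h1 : ‖q‖ < 1) (x : ℂ) :
    Summable fun k : ℕ => ‖-(q ^ (k + 1) * x)‖ := by
  simp only [norm_neg, norm_mul, norm_pow]
  exact (((summable_nat_add_iff 1).2
    (summable_geometric_of_lt_one (norm_nonneg q) h1))).mul_right _

theorem multipliable_eulerProd (h1 : ‖q‖ < 1) (x : ℂ) :
    Multipliable fun k : ℕ => 1 - q ^ (k + 1) * x := by
  simpa only [sub_eq_add_neg] using multipliable_one_add_of_summable (summable_norm_pow_mul h1 x)

theorem eulerProd_ne_zero (h1 : ‖q‖ < 1) {x : ℂ} (hx : ‖q‖ * ‖x‖ < 1) : eulerProd q x ≠ 0 := by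
  have := tprod_one_add_ne_zero_of_summable (f := fun k : ℕ => -(q ^ (k + 1) * x)) ?_
    (summable_norm_pow_mul h1 x)
  · simpa only [eulerProd, sub_eq_add_neg] using this
  · intro k h
    have h2 : q ^ (k + 1) * x = 1 := by linear_combination -h
    have h3 : ‖q‖ ^ (k + 1) * ‖x‖ = 1 := by rw [← norm_pow, ← norm_mul, h2, norm_one]
    have h4 : ‖q‖ ^ (k + 1) * ‖x‖ ≤ ‖q‖ * ‖x‖ := by
      gcongr
      exact pow_le_of_le_one (norm_nonneg q) h1.le (by omega)
    linarith

theorem eulerProd_shift (h1 : ‖q‖ < 1) (x : ℂ) :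
    eulerProd q x = (1 - q * x) * eulerProd q (q * x) := by
  have h : (fun k : ℕ => 1 - q ^ (k + 1 + 1) * x) = fun k : ℕ => 1 - q ^ (k + 1) * (q * x) := by
    ext k; ring
  have h2 : Multipliable fun k : ℕ => 1 - q ^ (k + 1 + 1) * x := by
    rw [h]; exact multipliable_eulerProd h1 _
  have h3 := tprod_eq_zero_mul' (f := fun k : ℕ => 1 - q ^ (k + 1) * x) h2
  rw [h] at h3
  simpa [eulerProd] using h3

theorem differentiable_eulerProd (h1 : ‖q‖ < 1) : Differentiable ℂ (eulerProd q) := by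
  intro x
  have hu : Summable fun k : ℕ => ‖q‖ ^ (k + 1) * (‖x‖ + 1) :=
    ((summable_nat_add_iff 1).2 (summable_geometric_of_lt_one (norm_nonneg q) h1)).mul_right _
  have h := Summable.hasProdLocallyUniformlyOn_nat_one_add (f := fun (k : ℕ) (y : ℂ) =>
    -(q ^ (k + 1) * y)) (K := Metric.ball x 1) Metric.isOpen_ball hu
    (Eventually.of_forall fun k y hy => by
      rw [norm_neg, norm_mul, norm_pow]
      gcongr
      have := norm_sub_norm_le y x
      rw [Metric.mem_ball, dist_eq_norm] at hy
      linarith)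
    (fun k => by fun_prop)
  have h2 := (h.tendstoLocallyUniformlyOn_finsetRange).differentiableOn
    (Eventually.of_forall fun N => by fun_prop) Metric.isOpen_ball
  have h3 := h2.differentiableAt (Metric.isOpen_ball.mem_nhds (Metric.mem_ball_self one_pos))
  simpa only [eulerProd, sub_eq_add_neg] using! h3

theorem differentiableAt_phi (h1 : ‖q‖ < 1) {x : ℂ} (hx : x ≠ 0) :
    DifferentiableAt ℂ (phi q) x := by
  have hE := differentiable_eulerProd h1
  have h2 : DifferentiableAt ℂ (fun y : ℂ => eulerProd q y⁻¹) x :=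
    (hE x⁻¹).comp x (differentiableAt_inv hx)
  exact (((differentiableAt_id.sub_const 1).mul (hE x)).mul h2).div_const _

theorem analyticAt_phi (h1 : ‖q‖ < 1) {x : ℂ} (hx : x ≠ 0) : AnalyticAt ℂ (phi q) x := by
  have : DifferentiableOn ℂ (phi q) {0}ᶜ := fun y hy =>
    (differentiableAt_phi h1 hy).differentiableWithinAt
  exact this.analyticAt (isOpen_compl_singleton.mem_nhds hx)

theorem phi_inv (x : ℂ) (hx : x ≠ 0) : phi q x⁻¹ = -phi q x / x := by
  simp only [phi, inv_inv]
  field_simp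
  ring

theorem phi_mul_q (h0 : q ≠ 0) (h1 : ‖q‖ < 1) (x : ℂ) (hx : x ≠ 0) :
    phi q (q * x) = -phi q x / x := by
  have e1 := eulerProd_shift h1 x
  have e2 := eulerProd_shift h1 (q * x)⁻¹
  have e3 : q * (q * x)⁻¹ = x⁻¹ := by field_simp
  rw [e3] at e2
  simp only [phi]
  rw [e2, e1]
  field_simp
  ring

theorem phi_ne_zero (h1 : ‖q‖ < 1) {x : ℂ} (hx : ‖q‖ < ‖x‖) (hx' : ‖q‖ * ‖x‖ < 1)
    (hx1 : x ≠ 1) : phi q x ≠ 0 := by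
  have hpos : 0 < ‖x‖ := (norm_nonneg q).trans_lt hx
  refine div_ne_zero (mul_ne_zero (mul_ne_zero (sub_ne_zero.2 hx1) (eulerProd_ne_zero h1 hx'))
    (eulerProd_ne_zero h1 ?_)) (pow_ne_zero 2 (eulerProd_ne_zero h1 ?_))
  · rw [norm_inv, ← div_eq_mul_inv, div_lt_one hpos]; exact hx
  · simpa using h1

/-- The quotient `phi q x / (x - 1)`. -/
noncomputable def phiReg (q x : ℂ) : ℂ := eulerProd q x * eulerProd q x⁻¹ / eulerProd q 1 ^ 2

theorem phi_eq (x : ℂ) : phi q x = (x - 1) * phiReg q x := by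
  simp only [phi, phiReg]; ring

theorem phiReg_one (h1 : ‖q‖ < 1) : phiReg q 1 = 1 := by
  have := eulerProd_ne_zero h1 (x := 1) (by simpa using h1)
  simp only [phiReg, inv_one]
  field_simp

theorem differentiableAt_phiReg (h1 : ‖q‖ < 1) {x : ℂ} (hx : x ≠ 0) :
    DifferentiableAt ℂ (phiReg q) x := by
  have hE := differentiable_eulerProd h1
  have h2 : DifferentiableAt ℂ (fun y : ℂ => eulerProd q y⁻¹) x :=
    (hE x⁻¹).comp x (differentiableAt_inv hx)
  exact ((hE x).mul h2).div_const _

theorem phiReg_ne_zero (h1 : ‖q‖ < 1) {x : ℂ} (hx : ‖q‖ < ‖x‖)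
    (hx' : ‖q‖ * ‖x‖ < 1) : phiReg q x ≠ 0 := by
  have hpos : 0 < ‖x‖ := (norm_nonneg q).trans_lt hx
  refine div_ne_zero (mul_ne_zero (eulerProd_ne_zero h1 hx')
    (eulerProd_ne_zero h1 ?_)) (pow_ne_zero 2 (eulerProd_ne_zero h1 ?_))
  · rw [norm_inv, ← div_eq_mul_inv, div_lt_one hpos]; exact hx
  · simpa using h1

theorem theta_eq (h1 : ‖q‖ < 1) (z : ℂ) : theta q z = exp (-z / 2) * phi q (exp z) := by
  have e1 := (multipliable_eulerProd h1 (exp z)).hasProd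
  have e2 := (multipliable_eulerProd h1 (exp z)⁻¹).hasProd
  have e3 := (multipliable_eulerProd h1 1).hasProd
  have hne : eulerProd q 1 ≠ 0 := eulerProd_ne_zero h1 (by simpa using h1)
  have e4 := (e1.mul e2).div₀ (e3.mul e3) (mul_ne_zero hne hne)
  have e5 := e4.tprod_eq
  have : (∏' k : ℕ, ((1 - q ^ (k + 1) * exp z) * (1 - q ^ (k + 1) * exp (-z)) /
      (1 - q ^ (k + 1)) ^ 2)) = eulerProd q (exp z) * eulerProd q (exp z)⁻¹ / eulerProd q 1 ^ 2 := by
    rw [pow_two (eulerProd q 1)]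
    refine Eq.trans (tprod_congr fun k => ?_) e5
    rw [exp_neg, mul_one, pow_two]
  rw [theta, this, phi]
  have h : exp (z / 2) = exp (-z / 2) * exp z := by rw [← exp_add]; ring_nf
  rw [h]; ring

theorem theta_neg (h1 : ‖q‖ < 1) (z : ℂ) : theta q (-z) = -theta q z := by
  rw [theta_eq h1, theta_eq h1, exp_neg z, phi_inv _ (exp_ne_zero z)]
  have h : exp (- -z / 2) = exp (-z / 2) * exp z := by rw [← exp_add]; ring_nf
  rw [h]
  field_simp [exp_ne_zero]

theorem differentiable_theta (h1 : ‖q‖ < 1) : Differentiable ℂ (theta q) := by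
  have : theta q = fun z => exp (-z / 2) * phi q (exp z) := funext (theta_eq h1)
  rw [this]
  intro z
  refine DifferentiableAt.mul (by fun_prop) ?_
  exact (differentiableAt_phi h1 (exp_ne_zero z)).comp z differentiableAt_exp

theorem theta_ne_zero_iff (h1 : ‖q‖ < 1) (z : ℂ) : theta q z ≠ 0 ↔ phi q (exp z) ≠ 0 := by
  rw [theta_eq h1]; simp [exp_ne_zero]

end

/-! ### Laurent coefficients on circles and quasi-periodic functions. -/

section

open Complex Filter Topology Real

variable {q : ℂ}

/-- The `m`-th Laurent coefficient of `f` on the circle `|z| = R`. -/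
noncomputable def laurentCoeff (f : ℂ → ℂ) (R : ℝ) (m : ℤ) : ℂ :=
  circleAverage (fun z => f z * z ^ (-m)) 0 R

theorem circleAverage_comp_mul (F : ℂ → ℂ) (q : ℂ) (R : ℝ) :
    circleAverage (fun z => F (q * z)) 0 R = circleAverage F 0 (‖q‖ * R) := by
  rw [circleAverage_eq_integral_add (f := F) (arg q), circleAverage_def]
  congr 2
  ext θ
  congr 1
  conv_lhs => rw [← norm_mul_exp_arg_mul_I q]
  simp only [circleMap_zero, ofReal_mul, ofReal_add, add_mul, Complex.exp_add]
  ring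

theorem circleAverage_eq_of_differentiable {F : ℂ → ℂ} {r R : ℝ} (hr : 0 < r) (hrR : r ≤ R)
    (hF : ∀ z, r ≤ ‖z‖ → ‖z‖ ≤ R → DifferentiableAt ℂ F z) :
    circleAverage F 0 R = circleAverage F 0 r := by
  rw [circleAverage_eq_circleIntegral (hr.trans_le hrR).ne', circleAverage_eq_circleIntegral hr.ne']
  congr 1
  refine Complex.circleIntegral_sub_center_inv_smul_eq_of_differentiable_on_annulus_off_countable
    hr hrR Set.countable_empty ?_ ?_
  · intro z hz
    simp only [Set.mem_sdiff, Metric.mem_closedBall, Metric.mem_ball, dist_zero_right, not_lt] at hz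
    exact (hF z hz.2 hz.1).continuousAt.continuousWithinAt
  · intro z hz
    simp only [Set.mem_sdiff, Metric.mem_closedBall, Metric.mem_ball, dist_zero_right, not_le,
      Set.mem_empty_iff_false, not_false_eq_true, and_true] at hz
    exact hF z hz.2.le hz.1.le

theorem laurentCoeff_eq_of_differentiable {f : ℂ → ℂ} {r R : ℝ} (hr : 0 < r) (hrR : r ≤ R)
    (hf : ∀ z, r ≤ ‖z‖ → ‖z‖ ≤ R → DifferentiableAt ℂ f z) (m : ℤ) :
    laurentCoeff f R m = laurentCoeff f r m := by
  refine circleAverage_eq_of_differentiable hr hrR fun z hz hz' => ?_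
  have : z ≠ 0 := norm_pos_iff.1 (hr.trans_le hz)
  exact (hf z hz hz').mul (differentiableAt_zpow.2 (Or.inl this))

theorem laurentCoeff_comp_mul (f : ℂ → ℂ) {q : ℂ} (h0 : q ≠ 0) (R : ℝ) (m : ℤ) :
    laurentCoeff (fun z => f (q * z)) R m = q ^ m * laurentCoeff f (‖q‖ * R) m := by
  unfold laurentCoeff
  rw [← circleAverage_comp_mul]
  have : (fun z => f (q * z) * z ^ (-m)) =
      fun z => q ^ m • (f (q * z) * (q * z) ^ (-m)) := by
    ext z
    rw [mul_zpow, smul_eq_mul, zpow_neg q]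
    field_simp
  rw [this, circleAverage_fun_smul, smul_eq_mul]

/-- The Laurent series on the circle is the Fourier series of θ ↦ f(R e^{iθ}). Absolute summability
of the Fourier coefficients of a continuous function gives pointwise convergence. -/
theorem hasSum_laurentCoeff {f : ℂ → ℂ} {R : ℝ} (hR : 0 < R)
    (hf : ∀ z, ‖z‖ = R → ContinuousAt f z)
    (hs : Summable fun m : ℤ => laurentCoeff f R m * (R : ℂ) ^ m) {z : ℂ} (hz : ‖z‖ = R) :
    HasSum (fun m : ℤ => laurentCoeff f R m * z ^ m) (f z) := by
  have : Fact (0 < 2 * π) := ⟨two_pi_pos⟩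
  have hc : Continuous fun x : AddCircle (2 * π) => f (R * (AddCircle.toCircle x : ℂ)) := by
    refine continuous_iff_continuousAt.2 fun x => ?_
    refine ContinuousAt.comp (f := fun x : AddCircle (2 * π) => (R * (AddCircle.toCircle x : ℂ)))
      (hf _ (by rw [norm_mul, Circle.norm_coe, norm_real, Real.norm_of_nonneg hR.le, mul_one])) ?_
    exact (continuous_const.mul
      (continuous_subtype_val.comp AddCircle.continuous_toCircle)).continuousAt
  let g : C(AddCircle (2 * π), ℂ) := ⟨_, hc⟩
  have hcm : ∀ θ : ℝ, (R : ℂ) * (AddCircle.toCircle (θ : AddCircle (2 * π)) : ℂ)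
      = circleMap 0 R θ := by
    intro θ
    rw [AddCircle.toCircle_apply_mk, circleMap_zero, Circle.coe_exp]
    congr 3
    rw [div_self two_pi_pos.ne', one_mul]
  have hRne : (R : ℂ) ≠ 0 := by exact_mod_cast hR.ne'
  have hfour : ∀ (n : ℤ) (θ : ℝ), (fourier n (θ : AddCircle (2 * π)) : ℂ)
      = (circleMap 0 R θ) ^ n * (R : ℂ) ^ (-n) := by
    intro n θ
    rw [fourier_apply, AddCircle.toCircle_zsmul, Circle.coe_zpow, ← hcm, mul_zpow, zpow_neg]
    field_simp
  have hcoef : ∀ n : ℤ, fourierCoeff g n = laurentCoeff f R n * (R : ℂ) ^ n := by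
    intro n
    rw [fourierCoeff_eq_intervalIntegral g n 0, laurentCoeff, circleAverage_def, zero_add,
      one_div, mul_comm _ ((R : ℂ) ^ n), ← smul_eq_mul ((R : ℂ) ^ n), smul_comm,
      ← intervalIntegral.integral_smul ((R : ℂ) ^ n)]
    refine congrArg _ (intervalIntegral.integral_congr fun θ _ => ?_)
    rw [hfour]
    simp only [smul_eq_mul, neg_neg, g, ContinuousMap.coe_mk, hcm]
    ring
  have hs' : Summable (fourierCoeff g) := by
    convert hs using 1
    exact funext hcoef
  have key := has_pointwise_sum_fourier_series_of_summable hs' ((arg z : ℝ) : AddCircle (2 * π))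
  have hzz : circleMap 0 R (arg z) = z := by
    rw [circleMap_zero, ← hz, norm_mul_exp_arg_mul_I]
  have e : g ((arg z : ℝ) : AddCircle (2 * π)) = f z := by
    simp only [g, ContinuousMap.coe_mk, hcm, hzz]
  rw [e] at key
  convert key using 2 with n
  rw [hcoef, hfour, hzz, smul_eq_mul, zpow_neg]
  field_simp

theorem eq_zero_of_laurentCoeff {f : ℂ → ℂ} {R : ℝ} (hR : 0 < R)
    (hf : ∀ z, ‖z‖ = R → ContinuousAt f z) (h : ∀ m, laurentCoeff f R m = 0)
    {z : ℂ} (hz : ‖z‖ = R) : f z = 0 := by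
  have := hasSum_laurentCoeff hR hf (by simp [h, summable_zero]) hz
  simp only [h, zero_mul] at this
  exact this.unique hasSum_zero

/-- Quasi-periodicity becomes the recursion c_{m+2} = q^m c_m for the Laurent coefficients, so the
theta functions of degree two form a space of dimension at most 2, with coordinates c_0 and c_1. -/
theorem eq_zero_of_quasiperiodic_two (h0 : q ≠ 0) {f : ℂ → ℂ}
    (hf : ∀ z, z ≠ 0 → DifferentiableAt ℂ f z) (hq : ∀ z, z ≠ 0 → f (q * z) = f z * z ^ (-2 : ℤ))
    (hc0 : laurentCoeff f 1 0 = 0) (hc1 : laurentCoeff f 1 1 = 0) {z : ℂ} (hz : z ≠ 0) :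
    f z = 0 := by
  have hrad : ∀ r, 0 < r → ∀ m, laurentCoeff f r m = laurentCoeff f 1 m := by
    intro r hr m
    rcases le_total r 1 with h | h
    · exact (laurentCoeff_eq_of_differentiable hr h
        (fun w hw _ => hf w (norm_pos_iff.1 (hr.trans_le hw))) m).symm
    · exact laurentCoeff_eq_of_differentiable one_pos h
        (fun w hw _ => hf w (norm_pos_iff.1 (one_pos.trans_le hw))) m
  have hrec : ∀ m, laurentCoeff f 1 (m + 2) = q ^ m * laurentCoeff f 1 m := by
    intro m
    have e := laurentCoeff_comp_mul f h0 1 m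
    rw [mul_one, hrad _ (norm_pos_iff.2 h0)] at e
    rw [← e]
    refine circleAverage_congr_sphere fun w hw => ?_
    have hw0 : w ≠ 0 := by
      rintro rfl
      simp at hw
    simp only
    rw [hq w hw0, mul_assoc, ← zpow_add₀ hw0]
    congr 2; ring
  have hall : ∀ m : ℤ, laurentCoeff f 1 m = 0 ∧ laurentCoeff f 1 (m + 1) = 0 := by
    intro m
    induction m using Int.induction_on with
    | zero => exact ⟨hc0, by simpa using hc1⟩
    | succ i ih =>
      refine ⟨ih.2, ?_⟩
      rw [add_assoc, show (1 : ℤ) + 1 = 2 by norm_num, hrec, ih.1, mul_zero]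
    | pred i ih =>
      have e := hrec (-(i : ℤ) - 1)
      rw [show (-(i : ℤ) - 1 + 2) = -i + 1 by ring, ih.2] at e
      refine ⟨?_, by simpa using ih.1⟩
      exact (mul_eq_zero.1 e.symm).resolve_left (zpow_ne_zero _ h0)
  exact eq_zero_of_laurentCoeff (norm_pos_iff.2 hz)
    (fun w hw => (hf w (norm_pos_iff.1 (hw ▸ norm_pos_iff.2 hz))).continuousAt)
    (fun m => by rw [hrad _ (norm_pos_iff.2 hz)]; exact (hall m).1) rfl

end

/-! ### The three-term relation for theta. -/

section

open Complex Filter Topology Real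

variable {q : ℂ}

theorem circleIntegrable_of_continuousAt {F : ℂ → ℂ} {R : ℝ} (hR : 0 < R)
    (hF : ∀ z, z ≠ 0 → ContinuousAt F z) : CircleIntegrable F 0 R := by
  refine ContinuousOn.circleIntegrable hR.le fun z hz => (hF z ?_).continuousWithinAt
  rintro rfl
  simp [hR.ne] at hz

/-- Up to the common factor e^{-w}, the four products are theta functions of degree two in z = e^w.
More than two such functions are linearly dependent; four are taken so that the relation can be
evaluated at w = x_0, …, x_3. -/
theorem exists_theta_relation (h0 : q ≠ 0) (h1 : ‖q‖ < 1) (x : Fin 4 → ℂ) :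
    ∃ α : Fin 4 → ℂ, α ≠ 0 ∧ ∀ w, ∑ j, theta q (w + x j) * theta q (w - x j) * α j = 0 := by
  set y : Fin 4 → ℂ := fun j => exp (x j) with hy
  have hy0 : ∀ j, y j ≠ 0 := fun j => exp_ne_zero _
  set h : Fin 4 → ℂ → ℂ := fun j z => phi q (z * y j) * phi q (z / y j) with hh
  have hd : ∀ j z, z ≠ 0 → DifferentiableAt ℂ (h j) z := by
    intro j z hz
    refine DifferentiableAt.mul ?_ ?_
    · exact DifferentiableAt.comp (f := fun z => z * y j) z
        (differentiableAt_phi h1 (mul_ne_zero hz (hy0 j))) (by fun_prop)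
    · exact DifferentiableAt.comp (f := fun z => z / y j) z
        (differentiableAt_phi h1 (div_ne_zero hz (hy0 j))) (by fun_prop)
  have hq : ∀ j z, z ≠ 0 → h j (q * z) = h j z * z ^ (-2 : ℤ) := by
    intro j z hz
    have hyj := hy0 j
    simp only [hh]
    rw [mul_assoc, mul_div_assoc, phi_mul_q h0 h1 _ (mul_ne_zero hz hyj),
      phi_mul_q h0 h1 _ (div_ne_zero hz hyj), zpow_neg, zpow_ofNat]
    field_simp
  -- Only two linear conditions have to be met; the zero rows make the matrix square and singular,
  -- so that it has a kernel vector.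
  let C : Matrix (Fin 4) (Fin 4) ℂ :=
    ![fun j => laurentCoeff (h j) 1 0, fun j => laurentCoeff (h j) 1 1, 0, 0]
  have hC : C.det = 0 := Matrix.det_eq_zero_of_row_eq_zero 3 fun j => by simp [C]
  obtain ⟨α, hα, hαC⟩ := Matrix.exists_mulVec_eq_zero_iff.2 hC
  refine ⟨α, hα, fun w => ?_⟩
  have hlin : ∀ m, laurentCoeff (fun z => ∑ j, α j • h j z) 1 m
      = ∑ j, laurentCoeff (h j) 1 m * α j := by
    intro m
    unfold laurentCoeff
    have e : (fun z => (∑ j, α j • h j z) * z ^ (-m)) =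
        fun z => ∑ j, α j • (h j z * z ^ (-m)) := by
      ext z
      simp only [Finset.sum_mul, smul_eq_mul, mul_assoc]
    have hci : ∀ j, CircleIntegrable (fun z => h j z * z ^ (-m)) 0 1 := fun j =>
      circleIntegrable_of_continuousAt one_pos fun z hz =>
        ((hd j z hz).continuousAt).mul (continuousAt_zpow₀ z _ (Or.inl hz))
    rw [e, circleAverage_fun_sum (fun j _ => (hci j).const_fun_smul)]
    refine Finset.sum_congr rfl fun j _ => ?_
    rw [circleAverage_fun_smul, smul_eq_mul, mul_comm]
  have hz := eq_zero_of_quasiperiodic_two h0 (f := fun z => ∑ j, α j • h j z)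
    (fun z hz => DifferentiableAt.fun_sum fun j _ => (hd j z hz).fun_const_smul _)
    (fun z hz => by
      simp only [smul_eq_mul, Finset.sum_mul]
      refine Finset.sum_congr rfl fun j _ => ?_
      rw [hq j z hz, ← mul_assoc])
    (by rw [hlin]; exact congrFun hαC 0) (by rw [hlin]; exact congrFun hαC 1) (exp_ne_zero w)
  have : ∀ j, theta q (w + x j) * theta q (w - x j) * α j
      = exp (-w) * (α j • h j (exp w)) := by
    intro j
    rw [theta_eq h1, theta_eq h1, Complex.exp_add, Complex.exp_sub]
    have e : exp (-w) = exp (-(w + x j) / 2) * exp (-(w - x j) / 2) := by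
      rw [← Complex.exp_add]; ring_nf
    rw [e]
    simp only [hh, hy, smul_eq_mul]
    ring
  simp only [this]
  rw [← Finset.mul_sum, hz, mul_zero]

/-- With g(x, y) = θ(x+y)θ(x-y), the relation at w = a, b, c, d says that the antisymmetric 4×4
matrix of g kills α ≠ 0. The left-hand side is its Pfaffian, and Pf · α_j = 0 for every j. -/
theorem theta_three_term (h0 : q ≠ 0) (h1 : ‖q‖ < 1) (a b c d : ℂ) :
    theta q (a + b) * theta q (a - b) * (theta q (c + d) * theta q (c - d))
      - theta q (a + c) * theta q (a - c) * (theta q (b + d) * theta q (b - d))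
      + theta q (a + d) * theta q (a - d) * (theta q (b + c) * theta q (b - c)) = 0 := by
  obtain ⟨α, hα, h⟩ := exists_theta_relation h0 h1 ![a, b, c, d]
  set g : ℂ → ℂ → ℂ := fun x y => theta q (x + y) * theta q (x - y) with hg
  have hanti : ∀ x y, g y x = -g x y := by
    intro x y
    simp only [hg]
    rw [add_comm y x, ← neg_sub x y, theta_neg h1]; ring
  have hdiag : ∀ x, g x x = 0 := fun x => by
    have := hanti x x
    linear_combination this / 2
  have r : ∀ w, g w a * α 0 + g w b * α 1 + g w c * α 2 + g w d * α 3 = 0 := fun w => by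
    simpa [Fin.sum_univ_four] using h w
  have ra := r a
  have rb := r b
  have rc := r c
  have rd := r d
  rw [hdiag] at ra
  rw [hanti a b, hdiag] at rb
  rw [hanti a c, hanti b c, hdiag] at rc
  rw [hanti a d, hanti b d, hanti c d, hdiag] at rd
  obtain ⟨j, hj⟩ := Function.ne_iff.1 hα
  change g a b * g c d - g a c * g b d + g a d * g b c = 0
  refine (mul_eq_zero.1 (?_ : _ * α j = 0)).resolve_right hj
  fin_cases j
  · change _ * α 0 = 0
    linear_combination -g c d * rb + g b d * rc - g b c * rd
  · change _ * α 1 = 0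
    linear_combination g c d * ra - g a d * rc + g a c * rd
  · change _ * α 2 = 0
    linear_combination -g b d * ra + g a d * rb - g a b * rd
  · change _ * α 3 = 0
    linear_combination g b c * ra - g a c * rb + g a b * rc

end

/-! ### Fay's identity and Frobenius' determinant. -/

section

open Complex Filter Topology Real

variable {q : ℂ}

theorem theta_fay (h0 : q ≠ 0) (h1 : ‖q‖ < 1) (t P₀ Q₀ P Q : ℂ) :
    theta q (P₀ - Q₀ + t) * theta q (P - Q + t) * (theta q (P₀ - Q) * theta q (P - Q₀))
      - theta q (P₀ - Q + t) * theta q (P - Q₀ + t) * (theta q (P₀ - Q₀) * theta q (P - Q)) =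
    theta q t * theta q (P - Q + (t + (P₀ - Q₀))) * (theta q (P₀ - P) * theta q (Q - Q₀)) := by
  -- The half-sums are chosen so that a-b = t, a+c = P₀-Q+t, a-c = P-Q₀+t, b+d = P₀-Q₀, b-d = P-Q,
  -- c+d = P₀-P and c-d = Q₀-Q.
  have h := theta_three_term h0 h1 (t + (P₀ - Q₀ + P - Q) / 2) ((P₀ - Q₀ + P - Q) / 2)
    ((P₀ - P + Q₀ - Q) / 2) ((P₀ - P - Q₀ + Q) / 2)
  rw [← neg_sub Q₀ Q, theta_neg h1]
  ring_nf at h ⊢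
  linear_combination h

theorem ThetaTwo_succ {n : ℕ} (P Q : Fin (n + 1) → ℂ) :
    ThetaTwo q P Q = (∏ j : Fin n, theta q (P 0 - P j.succ) * theta q (Q 0 - Q j.succ)) /
      (theta q (P 0 - Q 0) *
        ∏ j : Fin n, theta q (P 0 - Q j.succ) * theta q (Q 0 - P j.succ)) *
      ThetaTwo q (fun i => P i.succ) (fun i => Q i.succ) := by
  simp only [ThetaTwo]
  rw [Fin.prod_univ_succ, Fin.prod_univ_succ (fun i => theta q (P i - Q i)),
    Fin.prod_univ_succ (fun i => ∏ j ∈ Finset.Ioi i, theta q (P i - Q j) * theta q (Q i - P j))]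
  simp only [Fin.prod_Ioi_zero, Fin.prod_Ioi_succ]
  rw [div_mul_div_comm]
  congr 1
  ring

/-- Clearing the first column with the (0, 0) entry leaves, by `theta_fay`, a matrix of the same
shape with t replaced by t + P₀ - Q₀, up to row and column factors. The condition over all S keeps
every pivot of the induction nonzero. -/
theorem det_theta_of_generic (h0 : q ≠ 0) (h1 : ‖q‖ < 1) {n : ℕ} (P Q : Fin n → ℂ) (t : ℂ)
    (hPQ : ∀ i j, theta q (P i - Q j) ≠ 0)
    (ht : ∀ S : Finset (Fin n), theta q (t + ∑ i ∈ S, (P i - Q i)) ≠ 0) :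
    Matrix.det (Matrix.of fun i j =>
      theta q (P i - Q j + t) / (theta q (P i - Q j) * theta q t)) =
    theta q (t + ∑ i, (P i - Q i)) / theta q t * ThetaTwo q P Q := by
  induction n generalizing t with
  | zero =>
    have := ht ∅
    simp only [Finset.sum_empty, add_zero] at this
    simp [ThetaTwo, this]
  | succ n ih =>
    have ht0 : theta q t ≠ 0 := by simpa using ht ∅
    have ht1 : theta q (t + (P 0 - Q 0)) ≠ 0 := by simpa using ht {0}
    have h00 := hPQ 0 0
    set M : Matrix (Fin (n + 1)) (Fin (n + 1)) ℂ := Matrix.of fun i j =>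
      theta q (P i - Q j + t) / (theta q (P i - Q j) * theta q t) with hM
    have hM00 : M 0 0 = theta q (t + (P 0 - Q 0)) / (theta q (P 0 - Q 0) * theta q t) := by
      simp only [hM, Matrix.of_apply]; rw [add_comm]
    have hM00' : M 0 0 ≠ 0 := by
      rw [hM00]; exact div_ne_zero ht1 (mul_ne_zero h00 ht0)
    let c : Fin (n + 1) → ℂ := Fin.cons 0 fun i => M i.succ 0 / M 0 0
    let B : Matrix (Fin (n + 1)) (Fin (n + 1)) ℂ := fun i j => M i j - c i * M 0 j
    have hdet : M.det = B.det := by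
      refine Matrix.det_eq_of_forall_row_eq_smul_add_const c 0 rfl fun i j => ?_
      simp [B, c]
    have hB0 : ∀ i : Fin n, B i.succ 0 = 0 := by
      intro i
      simp only [B, c, Fin.cons_succ]
      field_simp
      ring
    have hB : ∀ i j : Fin n, B i.succ j.succ =
        theta q (P 0 - P i.succ) / theta q (Q 0 - P i.succ) *
        (theta q (Q 0 - Q j.succ) / theta q (P 0 - Q j.succ) *
        (theta q (P i.succ - Q j.succ + (t + (P 0 - Q 0))) /
          (theta q (P i.succ - Q j.succ) * theta q (t + (P 0 - Q 0))))) := by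
      intro i j
      have hf := theta_fay h0 h1 t (P 0) (Q 0) (P i.succ) (Q j.succ)
      rw [← neg_sub (Q 0) (Q j.succ), theta_neg h1] at hf
      have e1 := hPQ i.succ j.succ
      have e2 := hPQ i.succ 0
      have e3 := hPQ 0 j.succ
      rw [← neg_sub (P i.succ) (Q 0), theta_neg h1]
      simp only [B, c, Fin.cons_succ]
      rw [hM00]
      simp only [hM, Matrix.of_apply]
      rw [add_comm (P 0 - Q 0) t] at hf
      field_simp
      linear_combination hf
    rw [hdet, Matrix.det_succ_column_zero, Fin.sum_univ_succ]
    simp only [hB0, mul_zero, zero_mul, Finset.sum_const_zero, add_zero]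
    have hsub : B.submatrix (Fin.succAbove 0) Fin.succ = Matrix.of fun i j =>
        theta q (P 0 - P i.succ) / theta q (Q 0 - P i.succ) *
        (Matrix.of fun i j => (theta q (Q 0 - Q j.succ) / theta q (P 0 - Q j.succ) *
        (Matrix.of fun i j => (theta q (P i.succ - Q j.succ + (t + (P 0 - Q 0))) /
          (theta q (P i.succ - Q j.succ) * theta q (t + (P 0 - Q 0)))) : Matrix _ _ ℂ) i j) :
            Matrix (Fin n) (Fin n) ℂ) i j := by
      ext i j
      simp only [Matrix.submatrix_apply, Fin.succAbove_zero, hB, Matrix.of_apply]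
    rw [hsub, Matrix.det_mul_column, Matrix.det_mul_row,
      ih (fun i => P i.succ) (fun i => Q i.succ) _ (fun i j => hPQ _ _) ?_]
    · have hB00 : B 0 0 = M 0 0 := by simp [B, c]
      rw [hB00, hM00, ThetaTwo_succ, Fin.sum_univ_succ]
      simp only [Fin.val_zero, pow_zero, one_mul, Finset.prod_div_distrib, Finset.prod_mul_distrib]
      rw [add_assoc]
      field_simp
    · intro S
      have := ht (insert 0 (S.map (Fin.succEmb n)))
      rw [Finset.sum_insert (by simp), Finset.sum_map] at this
      simpa [add_assoc] using this

end

section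

open Complex Filter Topology Real

variable {q : ℂ}

theorem theta_eventually_ne_zero (h1 : ‖q‖ < 1) {t : ℂ} (ht : theta q t ≠ 0) (z : ℂ) :
    ∀ᶠ w in 𝓝[≠] z, theta q w ≠ 0 := by
  have ha : AnalyticOnNhd ℂ (theta q) Set.univ :=
    (differentiable_theta h1).differentiableOn.analyticOnNhd isOpen_univ
  rcases (ha z trivial).eventually_eq_zero_or_eventually_ne_zero with h | h
  · exact absurd (congrFun (ha.eq_of_eventuallyEq (g := fun _ => 0)
      (fun _ _ => analyticAt_const) h) t) ht
  · exact h

/-- Zeros of theta are isolated, so the pivot conditions hold for all s ≠ t near t; both sides are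
continuous at t. -/
theorem det_theta (h0 : q ≠ 0) (h1 : ‖q‖ < 1) {n : ℕ} (P Q : Fin n → ℂ) (t : ℂ)
    (hPQ : ∀ i j, theta q (P i - Q j) ≠ 0) (ht : theta q t ≠ 0) :
    Matrix.det (Matrix.of fun i j =>
      theta q (P i - Q j + t) / (theta q (P i - Q j) * theta q t)) =
    theta q (t + ∑ i, (P i - Q i)) / theta q t * ThetaTwo q P Q := by
  have hc := (differentiable_theta h1).continuous
  have hev : ∀ᶠ s in 𝓝[≠] t, ∀ S : Finset (Fin n), theta q (s + ∑ i ∈ S, (P i - Q i)) ≠ 0 := by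
    refine eventually_all.2 fun S => ?_
    set c := ∑ i ∈ S, (P i - Q i)
    refine Tendsto.eventually (f := fun s => s + c) ?_ (theta_eventually_ne_zero h1 ht (t + c))
    refine tendsto_nhdsWithin_of_tendsto_nhds_of_eventually_within _ ?_ ?_
    · exact (Continuous.tendsto (by fun_prop) t).mono_left nhdsWithin_le_nhds
    · filter_upwards [self_mem_nhdsWithin] with s hs h
      exact hs (add_right_cancel h)
  have hL : ContinuousAt (fun s => Matrix.det (Matrix.of fun i j =>
      theta q (P i - Q j + s) / (theta q (P i - Q j) * theta q s))) t := by
    refine ContinuousAt.comp (g := Matrix.det) (f := fun s => Matrix.of fun i j =>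
      theta q (P i - Q j + s) / (theta q (P i - Q j) * theta q s))
      (Continuous.matrix_det continuous_id).continuousAt ?_
    refine continuousAt_pi.2 fun i => continuousAt_pi.2 fun j => ?_
    exact ContinuousAt.div (by fun_prop) (by fun_prop) (mul_ne_zero (hPQ i j) ht)
  have hR : ContinuousAt (fun s => theta q (s + ∑ i, (P i - Q i)) / theta q s *
      ThetaTwo q P Q) t :=
    (ContinuousAt.div (by fun_prop) (by fun_prop) ht).mul continuousAt_const
  refine tendsto_nhds_unique (l := 𝓝[≠] t) (hL.tendsto.mono_left nhdsWithin_le_nhds)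
    ((hR.tendsto.mono_left nhdsWithin_le_nhds).congr' ?_)
  filter_upwards [hev] with s hs
  exact (det_theta_of_generic h0 h1 P Q s hPQ hs).symm

/-! ### The Kronecker function and its Laurent series in two annuli. -/

/-- The Kronecker function `θ(z + t) / (θ(z) θ(t))` in the coordinate `U = e^z`. -/
noncomputable def kron (q U t : ℂ) : ℂ := phi q (U * exp t) / (phi q U * phi q (exp t))

theorem theta_div_eq_kron (h1 : ‖q‖ < 1) (z t : ℂ) :
    theta q (z + t) / (theta q z * theta q t) = kron q (exp z) t := by
  rw [theta_eq h1, theta_eq h1, theta_eq h1, Complex.exp_add, kron]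
  have e : exp (-(z + t) / 2) = exp (-z / 2) * exp (-t / 2) := by
    rw [← Complex.exp_add]; ring_nf
  rw [e]
  have := exp_ne_zero (-z / 2)
  have := exp_ne_zero (-t / 2)
  rw [show exp (-z / 2) * phi q (exp z) * (exp (-t / 2) * phi q (exp t)) =
    (exp (-z / 2) * exp (-t / 2)) * (phi q (exp z) * phi q (exp t)) by ring,
    mul_div_mul_left _ _ (mul_ne_zero ‹_› ‹_›)]

theorem kron_mul_q (h0 : q ≠ 0) (h1 : ‖q‖ < 1) {U : ℂ} (hU : U ≠ 0) (t : ℂ) :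
    kron q (q * U) t = exp (-t) * kron q U t := by
  rw [kron, kron, mul_assoc, phi_mul_q h0 h1 _ (mul_ne_zero hU (exp_ne_zero t)),
    phi_mul_q h0 h1 _ hU, Complex.exp_neg]
  have := exp_ne_zero t
  by_cases h : phi q U = 0
  · simp [h]
  by_cases h' : phi q (exp t) = 0
  · simp [h']
  field_simp

/-- The Laurent coefficients of the Kronecker function in the annulus `1 < |U| < |q|⁻¹`. -/
noncomputable def kronCoeff (q : ℂ) (m : ℤ) (t : ℂ) : ℂ :=
  -(exp t * q ^ m) / (1 - exp t * q ^ m)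

/-- The values of `t` with `|q| < |e^t| < 1`. -/
def fundStrip (q : ℂ) : Set ℂ := {t | ‖q‖ < ‖exp t‖ ∧ ‖exp t‖ < 1}

theorem isOpen_fundStrip : IsOpen (fundStrip q) :=
  (isOpen_lt (f := fun _ : ℂ => ‖q‖) (g := fun t : ℂ => ‖exp t‖) (by fun_prop) (by fun_prop)).inter
    (isOpen_lt (f := fun t : ℂ => ‖exp t‖) (g := fun _ : ℂ => (1 : ℝ)) (by fun_prop) (by fun_prop))

theorem norm_exp_mul_pow_le {t : ℂ} (h1 : ‖q‖ < 1) (k : ℕ) :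
    ‖exp t * q ^ k‖ ≤ ‖exp t‖ := by
  rw [norm_mul, norm_pow]
  exact mul_le_of_le_one_right (norm_nonneg _) (pow_le_one₀ (norm_nonneg _) h1.le)

theorem norm_inv_le {t : ℂ} (h0 : q ≠ 0) (h1 : ‖q‖ < 1) (k : ℕ) :
    ‖(exp t * q ^ (-((k : ℤ) + 1)))⁻¹‖ ≤ ‖q‖ / ‖exp t‖ := by
  have hpos : 0 < ‖exp t‖ := norm_pos_iff.2 (exp_ne_zero t)
  rw [mul_inv, zpow_neg, inv_inv, norm_mul, norm_inv, norm_zpow, zpow_add₀ (norm_ne_zero_iff.2 h0),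
    zpow_natCast, zpow_one, div_eq_inv_mul]
  gcongr
  exact mul_le_of_le_one_left (norm_nonneg _) (pow_le_one₀ (norm_nonneg _) h1.le)

/-- In the strip, |e^t q^m| is less than 1 for m ≥ 0 and greater than 1 for m < 0. -/
theorem one_sub_ne_zero {t : ℂ} (h0 : q ≠ 0) (h1 : ‖q‖ < 1) (ht : t ∈ fundStrip q) (m : ℤ) :
    1 - exp t * q ^ m ≠ 0 := by
  intro h
  have h' : exp t * q ^ m = 1 := by linear_combination -h
  have hpos : 0 < ‖exp t‖ := norm_pos_iff.2 (exp_ne_zero t)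
  obtain ⟨k, rfl | rfl⟩ : ∃ k : ℕ, m = k ∨ m = -((k : ℤ) + 1) := by
    rcases Int.le_total 0 m with hm | hm
    · exact ⟨m.toNat, Or.inl (by omega)⟩
    · rcases eq_or_lt_of_le hm with rfl | hm
      · exact ⟨0, Or.inl (by simp)⟩
      · exact ⟨(-m - 1).toNat, Or.inr (by omega)⟩
  · have := norm_exp_mul_pow_le h1 k (t := t)
    rw [zpow_natCast] at h'
    rw [h', norm_one] at this
    exact absurd ht.2 (not_lt.2 this)
  · have := norm_inv_le h0 h1 k (t := t)
    rw [h', inv_one, norm_one, le_div_iff₀ hpos, one_mul] at this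
    exact absurd ht.1 (not_lt.2 this)

theorem phi_exp_ne_zero {t : ℂ} (h1 : ‖q‖ < 1) (ht : t ∈ fundStrip q) : phi q (exp t) ≠ 0 := by
  refine phi_ne_zero h1 ht.1 ?_ ?_
  · exact mul_lt_one_of_nonneg_of_lt_one_left (norm_nonneg _) h1 ht.2.le
  · intro h
    have := ht.2
    simp [h] at this

/-- A summable bound for the terms of the Laurent expansion of the Kronecker function. -/
theorem norm_kronCoeff_nat_le {t : ℂ} (h1 : ‖q‖ < 1) (ht : t ∈ fundStrip q) (k : ℕ) (U : ℂ) :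
    ‖kronCoeff q k t * U ^ k‖ ≤ (1 - ‖exp t‖)⁻¹ * (‖q‖ * ‖U‖) ^ k := by
  have hx := norm_exp_mul_pow_le h1 k (t := t)
  have hpos : 0 < 1 - ‖exp t‖ := by linarith [ht.2]
  have hden : 1 - ‖exp t‖ ≤ ‖1 - exp t * q ^ k‖ := by
    have := norm_sub_norm_le 1 (exp t * q ^ k)
    rw [norm_one] at this
    linarith
  rw [kronCoeff, zpow_natCast, norm_mul, norm_div, norm_neg, norm_mul, norm_pow, norm_pow, mul_pow,
    div_eq_mul_inv]
  calc ‖exp t‖ * ‖q‖ ^ k * ‖1 - exp t * q ^ k‖⁻¹ * ‖U‖ ^ k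
      ≤ 1 * ‖q‖ ^ k * (1 - ‖exp t‖)⁻¹ * ‖U‖ ^ k := by
        gcongr
        exact ht.2.le
    _ = _ := by ring

theorem norm_kronCoeff_neg_le {t : ℂ} (h0 : q ≠ 0) (h1 : ‖q‖ < 1) (ht : t ∈ fundStrip q) (k : ℕ)
    (U : ℂ) : ‖kronCoeff q (-((k : ℤ) + 1)) t * U ^ (-((k : ℤ) + 1))‖ ≤
      (1 - ‖q‖ / ‖exp t‖)⁻¹ * (‖U‖⁻¹) ^ (k + 1) := by
  have hx := norm_inv_le h0 h1 k (t := t)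
  have hb : 0 < ‖exp t‖ := norm_pos_iff.2 (exp_ne_zero t)
  have hpos : 0 < 1 - ‖q‖ / ‖exp t‖ := by
    have := (div_lt_one hb).2 ht.1
    linarith
  set x := exp t * q ^ (-((k : ℤ) + 1)) with hxdef
  have hx0 : x ≠ 0 := mul_ne_zero (exp_ne_zero t) (zpow_ne_zero _ h0)
  have hden : 1 - ‖q‖ / ‖exp t‖ ≤ ‖1 - x⁻¹‖ := by
    have := norm_sub_norm_le 1 x⁻¹
    rw [norm_one] at this
    linarith
  have e : kronCoeff q (-((k : ℤ) + 1)) t = (1 - x⁻¹)⁻¹ := by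
    have h2 := one_sub_ne_zero h0 h1 ht (-((k : ℤ) + 1))
    rw [← hxdef] at h2
    have h3 : 1 - x⁻¹ ≠ 0 := by
      intro h
      apply h2
      field_simp at h
      linear_combination -h
    rw [kronCoeff, ← hxdef]
    refine eq_inv_of_mul_eq_one_left ?_
    rw [div_mul_eq_mul_div, div_eq_one_iff_eq h2]
    field_simp
    ring
  rw [e, norm_mul, norm_inv, norm_zpow, zpow_neg, ← inv_zpow]
  rw [show ((k : ℤ) + 1) = ((k + 1 : ℕ) : ℤ) by push_cast; ring, zpow_natCast]
  gcongr

theorem summable_kronCoeff {t U : ℂ} (h0 : q ≠ 0) (h1 : ‖q‖ < 1) (ht : t ∈ fundStrip q)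
    (hU : 1 < ‖U‖) (hU' : ‖q‖ * ‖U‖ < 1) :
    Summable fun m : ℤ => kronCoeff q m t * U ^ m := by
  refine Summable.of_nat_of_neg_add_one ?_ ?_
  · refine Summable.of_norm_bounded
      ((summable_geometric_of_lt_one (by positivity) hU').mul_left (1 - ‖exp t‖)⁻¹) fun k => ?_
    simpa using norm_kronCoeff_nat_le h1 ht k U
  · refine Summable.of_norm_bounded
      (((summable_nat_add_iff 1).2 (summable_geometric_of_lt_one (inv_nonneg.2 (norm_nonneg U))
        (inv_lt_one_of_one_lt₀ hU))).mul_left (1 - ‖q‖ / ‖exp t‖)⁻¹) fun k => ?_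
    exact norm_kronCoeff_neg_le h0 h1 ht k U

end

section

open Complex Filter Topology Real

variable {q : ℂ}

theorem circleAverage_div_sub_one_of_gt {R : ℝ} (hR : 1 < R) :
    circleAverage (fun z : ℂ => z / (z - 1)) 0 R = 1 := by
  rw [circleAverage_eq_circleIntegral (by linarith)]
  have e : (∮ z in C(0, R), (z - 0)⁻¹ • (z / (z - 1))) = ∮ z in C(0, R), (z - 1)⁻¹ := by
    refine circleIntegral.integral_congr (by linarith) fun z hz => ?_
    have hz0 : z ≠ 0 := by
      rintro rfl
      simp at hz
      linarith
    simp only [sub_zero, smul_eq_mul]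
    field_simp
  rw [e, circleIntegral.integral_sub_inv_of_mem_ball (by simpa using hR), smul_eq_mul]
  exact inv_mul_cancel₀ two_pi_I_ne_zero

theorem circleAverage_div_sub_one_of_lt {R : ℝ} (hR0 : 0 < R) (hR : R < 1) :
    circleAverage (fun z : ℂ => z / (z - 1)) 0 R = 0 := by
  rw [circleAverage_eq_circleIntegral hR0.ne']
  have e : (∮ z in C(0, R), (z - 0)⁻¹ • (z / (z - 1))) = ∮ z in C(0, R), (z - 1)⁻¹ := by
    refine circleIntegral.integral_congr hR0.le fun z hz => ?_
    have hz0 : z ≠ 0 := by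
      rintro rfl
      simp at hz
      linarith
    simp only [sub_zero, smul_eq_mul]
    field_simp
  rw [e]
  have : (∮ z in C(0, R), (z - 1 : ℂ)⁻¹) = 0 := by
    have hd : ∀ z : ℂ, ‖z‖ ≤ R → DifferentiableAt ℂ (fun z : ℂ => (z - 1)⁻¹) z := by
      intro z hz
      refine DifferentiableAt.inv (by fun_prop) ?_
      intro h
      have : z = 1 := by linear_combination h
      rw [this, norm_one] at hz
      linarith
    refine Complex.circleIntegral_eq_zero_of_differentiable_on_off_countable hR0.le
      Set.countable_empty (fun z hz => ?_) (fun z hz => ?_)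
    · exact (hd z (by simpa using hz)).continuousAt.continuousWithinAt
    · exact hd z (by simpa using (Metric.ball_subset_closedBall hz.1))
  rw [this, smul_zero]

theorem differentiableAt_kron {U t : ℂ} (h1 : ‖q‖ < 1) (hU : U ≠ 0) (hU' : phi q U ≠ 0)
    (ht : phi q (exp t) ≠ 0) : DifferentiableAt ℂ (fun z => kron q z t) U := by
  refine DifferentiableAt.div ?_ ((differentiableAt_phi h1 hU).mul_const _) (mul_ne_zero hU' ht)
  exact DifferentiableAt.comp (f := fun z => z * exp t) U
    (differentiableAt_phi h1 (mul_ne_zero hU (exp_ne_zero t))) (by fun_prop)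

/-- Between the two circles the only pole is the simple one at U = 1, of residue 1. -/
theorem laurentCoeff_kron_sub {t : ℂ} (h0 : q ≠ 0) (h1 : ‖q‖ < 1) (ht : t ∈ fundStrip q)
    {r R : ℝ} (hr : ‖q‖ < r) (hr1 : r < 1) (hR1 : 1 < R) (hR : ‖q‖ * R < 1) (m : ℤ) :
    laurentCoeff (fun z => kron q z t) R m = laurentCoeff (fun z => kron q z t) r m + 1 := by
  have hq0 : 0 < ‖q‖ := norm_pos_iff.2 h0
  have hr0 : 0 < r := hq0.trans hr
  have hφt := phi_exp_ne_zero h1 ht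
  -- A is holomorphic near 1 and `kron q z t * z ^ (-m)` equals z A(z)/(z-1). Since A(1) = 1, this
  -- splits into z/(z-1) and the holomorphic function z · `dslope A 1 z`.
  let A : ℂ → ℂ := fun z => phi q (z * exp t) / (phiReg q z * phi q (exp t)) * z ^ (-m - 1)
  let O : Set ℂ := {z | ‖q‖ < ‖z‖ ∧ ‖q‖ * ‖z‖ < 1}
  have hO : IsOpen O :=
    (isOpen_lt (f := fun _ : ℂ => ‖q‖) (g := fun z : ℂ => ‖z‖) (by fun_prop) (by fun_prop)).inter
    (isOpen_lt (f := fun z : ℂ => ‖q‖ * ‖z‖) (g := fun _ => (1 : ℝ)) (by fun_prop) (by fun_prop))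
  have h1O : (1 : ℂ) ∈ O := ⟨by simpa using h1, by simpa using h1⟩
  have hO0 : ∀ z ∈ O, z ≠ 0 := fun z hz => norm_pos_iff.1 (hq0.trans hz.1)
  have hA : DifferentiableOn ℂ A O := by
    intro z hz
    have hz0 := hO0 z hz
    refine DifferentiableAt.differentiableWithinAt ?_
    refine DifferentiableAt.mul (DifferentiableAt.div ?_
      ((differentiableAt_phiReg h1 hz0).mul_const _)
      (mul_ne_zero (phiReg_ne_zero h1 hz.1 hz.2) hφt)) (differentiableAt_zpow.2 (Or.inl hz0))
    exact DifferentiableAt.comp (f := fun z => z * exp t) z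
      (differentiableAt_phi h1 (mul_ne_zero hz0 (exp_ne_zero t))) (by fun_prop)
  have hA1 : A 1 = 1 := by
    simp only [A, one_mul, phiReg_one h1, one_zpow, mul_one]
    exact div_self hφt
  let k : ℂ → ℂ := dslope A 1
  have hk : ∀ z ∈ O, DifferentiableAt ℂ k z := fun z hz =>
    ((Complex.differentiableOn_dslope (hO.mem_nhds h1O)).2 hA).differentiableAt (hO.mem_nhds hz)
  have hsplit : ∀ z ∈ O, z ≠ 1 → kron q z t * z ^ (-m) = z * k z + z / (z - 1) := by
    intro z hz hz1
    have hz0 := hO0 z hz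
    have hz1' : z - 1 ≠ 0 := sub_ne_zero.2 hz1
    have hp := phiReg_ne_zero h1 hz.1 hz.2
    simp only [k]
    rw [dslope_of_ne _ hz1, slope_def_field, hA1]
    simp only [A]
    rw [kron, phi_eq z, zpow_sub₀ hz0, zpow_one]
    field_simp
    ring
  have hkey : ∀ ρ : ℝ, ‖q‖ < ρ → ‖q‖ * ρ < 1 → ρ ≠ 1 →
      laurentCoeff (fun z => kron q z t) ρ m = circleAverage (fun z => z * k z) 0 ρ
        + circleAverage (fun z : ℂ => z / (z - 1)) 0 ρ := by
    intro ρ hρ hρ' hρ1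
    have hρ0 : 0 < ρ := hq0.trans hρ
    have hmem : ∀ z ∈ Metric.sphere (0 : ℂ) ρ, z ∈ O ∧ z ≠ 1 := by
      intro z hz
      have hz' : ‖z‖ = ρ := by simpa using hz
      refine ⟨⟨hz' ▸ hρ, hz' ▸ hρ'⟩, ?_⟩
      rintro rfl
      exact hρ1 (by simpa using hz'.symm)
    rw [← circleAverage_fun_add, laurentCoeff]
    · refine circleAverage_congr_sphere fun z hz => ?_
      rw [abs_of_pos hρ0] at hz
      exact hsplit z (hmem z hz).1 (hmem z hz).2
    · refine ContinuousOn.circleIntegrable hρ0.le fun z hz => ?_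
      exact (continuousAt_id.mul (hk z (hmem z hz).1).continuousAt).continuousWithinAt
    · refine ContinuousOn.circleIntegrable hρ0.le fun z hz => ?_
      exact (continuousAt_id.div (continuousAt_id.sub continuousAt_const)
        (sub_ne_zero.2 (hmem z hz).2)).continuousWithinAt
  rw [hkey R (h1.trans hR1) hR hR1.ne', hkey r hr _ hr1.ne, circleAverage_div_sub_one_of_gt hR1,
    circleAverage_div_sub_one_of_lt hr0 hr1, add_zero]
  · congr 1
    refine circleAverage_eq_of_differentiable hr0 (by linarith) fun z hz hz' => ?_
    refine differentiableAt_id.mul (hk z ⟨hr.trans_le hz, ?_⟩)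
    exact lt_of_le_of_lt (by gcongr) hR
  · exact mul_lt_one_of_nonneg_of_lt_one_left hq0.le h1 hr1.le

/-- Two linear equations determine the coefficients c on |z| = R and c' on |z| = |q|R: the residue
gives c = c' + 1, and quasi-periodicity gives e^{-t} c = q^m c'. -/
theorem laurentCoeff_kron {t : ℂ} (h0 : q ≠ 0) (h1 : ‖q‖ < 1) (ht : t ∈ fundStrip q)
    {R : ℝ} (hR1 : 1 < R) (hR : ‖q‖ * R < 1) (m : ℤ) :
    laurentCoeff (fun z => kron q z t) R m = kronCoeff q m t := by
  have hq0 : 0 < ‖q‖ := norm_pos_iff.2 h0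
  have e1 := laurentCoeff_kron_sub h0 h1 ht (r := ‖q‖ * R) (by nlinarith) hR hR1 hR m
  have e2 := laurentCoeff_comp_mul (fun z => kron q z t) h0 R m
  have e3 : laurentCoeff (fun z => kron q (q * z) t) R m
      = exp (-t) * laurentCoeff (fun z => kron q z t) R m := by
    rw [laurentCoeff, laurentCoeff, ← smul_eq_mul, ← circleAverage_fun_smul]
    refine circleAverage_congr_sphere fun z hz => ?_
    have hz0 : z ≠ 0 := by
      rintro rfl
      rw [abs_of_pos (by linarith)] at hz
      simp at hz
      linarith
    simp only [smul_eq_mul]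
    rw [kron_mul_q h0 h1 hz0, mul_assoc]
  rw [e3] at e2
  have hx := one_sub_ne_zero h0 h1 ht m
  rw [kronCoeff, eq_div_iff hx]
  have e4 : laurentCoeff (fun z => kron q z t) R m =
      exp t * (q ^ m * laurentCoeff (fun z => kron q z t) (‖q‖ * R) m) := by
    rw [← e2, ← mul_assoc, ← Complex.exp_add]
    simp
  linear_combination e4 + (-(exp t * q ^ m)) * e1

theorem ne_one_of_one_lt_norm {U : ℂ} (hU : 1 < ‖U‖) : U ≠ 1 := by
  rintro rfl
  simp at hU

theorem phi_ne_zero_of_one_lt {U : ℂ} (h1 : ‖q‖ < 1) (hU : 1 < ‖U‖) (hU' : ‖q‖ * ‖U‖ < 1) :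
    phi q U ≠ 0 :=
  phi_ne_zero h1 (h1.trans hU) hU' (ne_one_of_one_lt_norm hU)

theorem hasSum_kron {t U : ℂ} (h0 : q ≠ 0) (h1 : ‖q‖ < 1) (ht : t ∈ fundStrip q)
    (hU : 1 < ‖U‖) (hU' : ‖q‖ * ‖U‖ < 1) :
    HasSum (fun m : ℤ => kronCoeff q m t * U ^ m) (kron q U t) := by
  have h := hasSum_laurentCoeff (f := fun z => kron q z t) (zero_lt_one.trans hU) ?_ ?_ (z := U) rfl
  · simpa only [laurentCoeff_kron h0 h1 ht hU hU'] using h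
  · intro z hz
    exact (differentiableAt_kron h1 (norm_pos_iff.1 (by linarith))
      (phi_ne_zero_of_one_lt h1 (hz ▸ hU) (hz ▸ hU')) (phi_exp_ne_zero h1 ht)).continuousAt
  · simp only [laurentCoeff_kron h0 h1 ht hU hU']
    exact summable_kronCoeff h0 h1 ht (by simpa using hU) (by simpa using hU')

/-- Apply the expansion at U/q and multiply by e^{-t}; with x = e^t q^m the new coefficient is
-1/(1-x) = -x/(1-x) - 1. -/
theorem hasSum_kron_of_lt {t U : ℂ} (h0 : q ≠ 0) (h1 : ‖q‖ < 1) (ht : t ∈ fundStrip q)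
    (hU : ‖q‖ < ‖U‖) (hU' : ‖U‖ < 1) :
    HasSum (fun m : ℤ => (kronCoeff q m t - 1) * U ^ m) (kron q U t) := by
  have hq0 : 0 < ‖q‖ := norm_pos_iff.2 h0
  have hU0 : U ≠ 0 := norm_pos_iff.1 (hq0.trans hU)
  have h := (hasSum_kron h0 h1 ht (U := U / q) (by rwa [norm_div, one_lt_div hq0])
    (by rw [norm_div]; field_simp; exact hU')).mul_left (exp (-t))
  rw [← kron_mul_q h0 h1 (div_ne_zero hU0 h0), mul_div_cancel₀ _ h0] at h
  have e : ∀ m : ℤ, (kronCoeff q m t - 1) * U ^ m =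
      exp (-t) * (kronCoeff q m t * (U / q) ^ m) := by
    intro m
    have hx := one_sub_ne_zero h0 h1 ht m
    have hq := zpow_ne_zero m h0
    have he := exp_ne_zero t
    rw [kronCoeff, div_zpow, Complex.exp_neg]
    field_simp
    ring
  simpa only [e] using h

end

/-! ### Mean values over tori. -/

section

open Complex Filter Topology Real MeasureTheory

theorem hasSum_prod_of_summable_norm {n : ℕ} (a : Fin n → ℤ → ℂ) (s : Fin n → ℂ)
    (h : ∀ i, HasSum (a i) (s i)) :
    HasSum (fun m : Fin n → ℤ => ∏ i, a i (m i)) (∏ i, s i) := by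
  induction n with
  | zero =>
    simp
  | succ n ih =>
    have h' := ih (fun i => a i.succ) (fun i => s i.succ) fun i => h i.succ
    have hs : Summable fun x : ℤ × (Fin n → ℤ) => a 0 x.1 * ∏ i : Fin n, a i.succ (x.2 i) :=
      summable_mul_of_summable_norm (g := fun m : Fin n → ℤ => ∏ i : Fin n, a i.succ (m i))
        (h 0).summable.norm h'.summable.norm
    have hmul := HasSum.mul (g := fun m : Fin n → ℤ => ∏ i : Fin n, a i.succ (m i)) (h 0) h' hs
    let E : ℤ × (Fin n → ℤ) ≃ (Fin (n + 1) → ℤ) := Fin.consEquiv fun _ : Fin (n + 1) => ℤ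
    rw [Fin.prod_univ_succ, ← E.hasSum_iff]
    have e : (fun m : Fin (n + 1) → ℤ => ∏ i, a i (m i)) ∘ E =
        fun x : ℤ × (Fin n → ℤ) => a 0 x.1 * ∏ i : Fin n, a i.succ (x.2 i) := by
      funext x
      simp [E, Fin.prod_univ_succ, Fin.consEquiv]
    rw [e]
    exact hmul

/-- The mean value of a function over the torus `|v_j| = r_j`. -/
noncomputable def torusMean {n : ℕ} (g : (Fin n → ℂ) → ℂ) (r : Fin n → ℝ) : ℂ :=
  ((2 * π : ℂ) ^ n)⁻¹ * ∫ θ in Set.Icc (0 : Fin n → ℝ) fun _ => 2 * π, g (torusMap 0 r θ)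

theorem torusMap_ne_zero {n : ℕ} {r : Fin n → ℝ} (hr : ∀ i, 0 < r i) (θ : Fin n → ℝ) (i : Fin n) :
    torusMap 0 r θ i ≠ 0 := by
  simp [torusMap, (hr i).ne', Complex.exp_ne_zero]

theorem norm_torusMap {n : ℕ} {r : Fin n → ℝ} (hr : ∀ i, 0 < r i) (θ : Fin n → ℝ) (i : Fin n) :
    ‖torusMap 0 r θ i‖ = r i := by
  simp [torusMap, abs_of_pos (hr i)]

theorem cycle_eq_torusMean {n : ℕ} (g : (Fin n → ℂ) → ℂ) {r : Fin n → ℝ} (hr : ∀ i, 0 < r i) :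
    (1 / (2 * π * I)) ^ n * (∯ v in T(0, r), (∏ j, (v j)⁻¹) * g v) = torusMean g r := by
  have e : ∀ θ : Fin n → ℝ, (∏ i, r i * Complex.exp (θ i * I) * I : ℂ) •
      ((∏ j, (torusMap 0 r θ j)⁻¹) * g (torusMap 0 r θ)) = I ^ n * g (torusMap 0 r θ) := by
    intro θ
    rw [smul_eq_mul, ← mul_assoc, ← Finset.prod_mul_distrib]
    congr 1
    rw [← Fin.prod_const]
    refine Finset.prod_congr rfl fun i _ => ?_
    have := torusMap_ne_zero hr θ i
    have e2 : (r i * Complex.exp (θ i * I) : ℂ) = torusMap 0 r θ i := by simp [torusMap]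
    rw [e2]
    field_simp
  rw [torusIntegral]
  simp only [e]
  rw [integral_const_mul, torusMean, ← mul_assoc]
  congr 1
  rw [one_div, mul_inv, mul_pow, mul_assoc, ← mul_pow, inv_mul_cancel₀ I_ne_zero, one_pow, mul_one,
    inv_pow]

theorem torusMean_monomial {n : ℕ} {r : Fin n → ℝ} (hr : ∀ i, 0 < r i) (e : Fin n → ℤ) :
    torusMean (fun v => ∏ i, v i ^ e i) r = if e = 0 then 1 else 0 := by
  have h1 : ∀ (ρ : ℝ) (k : ℤ), 0 < ρ →
      (∫ θ in Set.Icc 0 (2 * π), ((ρ : ℂ) * Complex.exp (θ * I)) ^ k) =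
        if k = 0 then (2 * π : ℂ) else 0 := by
    intro ρ k hρ
    have h2 : circleAverage (fun z : ℂ => z ^ k) 0 ρ = if k = 0 then 1 else 0 := by
      split_ifs with hk
      · simp [hk, circleAverage_const]
      · rw [circleAverage_eq_circleIntegral hρ.ne']
        have : (∮ z in C(0, ρ), (z - 0)⁻¹ • z ^ k) = ∮ z in C(0, ρ), (z - 0) ^ (k - 1) := by
          refine circleIntegral.integral_congr hρ.le fun z hz => ?_
          have hz0 : z ≠ 0 := by
            rintro rfl
            simp at hz
            linarith
          simp only [sub_zero, smul_eq_mul]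
          rw [zpow_sub_one₀ hz0, mul_comm]
        rw [this, circleIntegral.integral_sub_zpow_of_ne (by omega), smul_zero]
    rw [circleAverage_def] at h2
    simp only [circleMap_zero] at h2
    rw [integral_Icc_eq_integral_Ioc, ← intervalIntegral.integral_of_le two_pi_pos.le]
    have h3 : ((2 * π : ℝ) : ℂ) ≠ 0 := by exact_mod_cast two_pi_pos.ne'
    rw [real_smul] at h2
    rw [ofReal_inv, inv_mul_eq_iff_eq_mul₀ h3] at h2
    rw [h2]
    split_ifs <;> simp
  rw [torusMean]
  simp only [torusMap, Pi.zero_apply, zero_add]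
  rw [← Set.pi_univ_Icc, volume_pi, Measure.restrict_pi_pi,
    integral_fintype_prod_eq_prod (f := fun i θ => ((r i : ℂ) * Complex.exp ((θ : ℝ) * I)) ^ e i)]
  simp only [Pi.zero_apply, h1 _ _ (hr _)]
  split_ifs with he
  · simp [he]
  · obtain ⟨i, hi⟩ := Function.ne_iff.1 he
    rw [Finset.prod_eq_zero (Finset.mem_univ i), mul_zero]
    exact if_neg hi

theorem hasSum_torusMean {n : ℕ} {r : Fin n → ℝ} {ι : Type*} [Countable ι]
    (g : (Fin n → ℂ) → ℂ) (F : ι → (Fin n → ℂ) → ℂ) (bound : ι → ℝ)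
    (hF : ∀ i, Continuous fun θ => F i (torusMap 0 r θ))
    (hb : ∀ i θ, ‖F i (torusMap 0 r θ)‖ ≤ bound i) (hs : Summable bound)
    (h : ∀ θ, HasSum (fun i => F i (torusMap 0 r θ)) (g (torusMap 0 r θ))) :
    HasSum (fun i => torusMean (F i) r) (torusMean g r) := by
  refine HasSum.mul_left _ (hasSum_integral_of_dominated_convergence (fun i _ => bound i)
    (fun i => (hF i).aestronglyMeasurable) (fun i => Eventually.of_forall (hb i))
    (Eventually.of_forall fun _ => hs) ?_ (Eventually.of_forall h))
  exact continuousOn_const.integrableOn_compact isCompact_Icc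

theorem continuous_torusMap {n : ℕ} (r : Fin n → ℝ) : Continuous (torusMap (0 : Fin n → ℂ) r) := by
  unfold torusMap
  fun_prop

end

/-! ### The integral of the determinant of Kronecker functions. -/

section

open Complex Filter Topology Real MeasureTheory

/-- A level set of m contributes a single factor p(k), whatever its size. If the level of 0 occurs
again, subtracting from row 0 the row of its next occurrence leaves the first unit vector, so index
0 can be dropped without changing the set of levels. Otherwise row 0 has only its diagonal entry. -/
theorem det_levels {n : ℕ} (p : ℤ → ℂ) (m : Fin n → ℤ) :
    Matrix.det (Matrix.of fun i j : Fin n =>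
      if m i = m j then p (m i) - (if j < i then 1 else 0) else 0) =
    ∏ k ∈ Finset.univ.image m, p k := by
  induction n with
  | zero => simp
  | succ n ih =>
    set M : Matrix (Fin (n + 1)) (Fin (n + 1)) ℂ := Matrix.of fun i j =>
      if m i = m j then p (m i) - (if j < i then 1 else 0) else 0 with hM
    have hsub : (M.submatrix Fin.succ Fin.succ).det
        = ∏ k ∈ Finset.univ.image (fun i : Fin n => m i.succ), p k := by
      rw [← ih fun i => m i.succ]
      congr 1
      ext i j
      simp [hM]
    have himg : Finset.univ.image m
        = insert (m 0) (Finset.univ.image (fun i : Fin n => m i.succ)) := by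
      ext k
      simp [Fin.exists_fin_succ, eq_comm]
    rw [himg]
    by_cases hex : ∃ j : Fin n, m j.succ = m 0
    · obtain ⟨j, hj, hmin⟩ := WellFounded.has_min (wellFounded_lt (α := Fin n))
        {j | m j.succ = m 0} hex
      have hj' : m j.succ = m 0 := hj
      rw [Finset.insert_eq_of_mem (Finset.mem_image.2 ⟨j, Finset.mem_univ _, hj'⟩), ← hsub,
        ← Matrix.det_updateRow_add_smul_self M (i := 0) (j := j.succ) (Fin.succ_ne_zero j).symm
        (-1), Matrix.det_succ_row_zero, Fin.sum_univ_succ]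
      have hz : ∀ k : Fin n, (M 0 + (-1 : ℂ) • M j.succ) k.succ = 0 := by
        intro k
        by_cases hk : m 0 = m k.succ
        · have : ¬ k < j := fun h => hmin k hk.symm h
          simp [hM, hj', hk, this]
        · simp [hM, hj', hk]
      have h0 : (M 0 + (-1 : ℂ) • M j.succ) 0 = 1 := by
        simp [hM, hj']
      simp only [Matrix.updateRow_self, hz, h0, mul_zero, zero_mul, Finset.sum_const_zero, add_zero,
        Fin.val_zero, pow_zero, one_mul, Fin.succAbove_zero]
      congr 1
    · push Not at hex
      rw [Finset.prod_insert (by simpa using hex), ← hsub, Matrix.det_succ_row_zero,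
        Fin.sum_univ_succ]
      have hz : ∀ k : Fin n, M 0 k.succ = 0 := fun k => by
        simp [hM, (hex k).symm]
      simp only [hz, mul_zero, zero_mul, Finset.sum_const_zero, add_zero,
        Fin.val_zero, pow_zero, one_mul]
      simp [hM, Fin.succAbove_zero]

theorem torusMean_congr {n : ℕ} {r : Fin n → ℝ} {f g : (Fin n → ℂ) → ℂ}
    (h : ∀ θ, f (torusMap 0 r θ) = g (torusMap 0 r θ)) : torusMean f r = torusMean g r := by
  simp only [torusMean, h]

theorem torusMean_const_mul {n : ℕ} {r : Fin n → ℝ} (c : ℂ) (f : (Fin n → ℂ) → ℂ) :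
    torusMean (fun v => c * f v) r = c * torusMean f r := by
  simp only [torusMean, integral_const_mul]
  ring

theorem torusMean_sum {n : ℕ} {r : Fin n → ℝ} {ι : Type*} (s : Finset ι)
    (F : ι → (Fin n → ℂ) → ℂ) (hF : ∀ i, Continuous fun θ => F i (torusMap 0 r θ)) :
    torusMean (fun v => ∑ i ∈ s, F i v) r = ∑ i ∈ s, torusMean (F i) r := by
  simp only [torusMean]
  rw [integral_finsetSum _ fun i _ => (hF i).continuousOn.integrableOn_compact isCompact_Icc,
    Finset.mul_sum]

variable {q : ℂ}

theorem OmegaGW.pos {n : ℕ} {u : Fin n → ℂ} {r : Fin n → ℝ} (h : OmegaGW q u r) (i : Fin n) :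
    0 < r i := h.1 i

/-- The ordering puts u_i v_i / v_j inside the unit circle exactly when j < i, and this selects the
annulus of expansion. -/
theorem hasSum_kron_pair {n : ℕ} {u : Fin n → ℂ} {r : Fin n → ℝ} (h : OmegaGW q u r)
    (h0 : q ≠ 0) (h1 : ‖q‖ < 1) {t : ℂ} (ht : t ∈ fundStrip q) {v : Fin n → ℂ}
    (hv : ∀ i, ‖v i‖ = r i) (i j : Fin n) :
    HasSum (fun m : ℤ => (kronCoeff q m t - (if j < i then 1 else 0)) * (u i * v i / v j) ^ m)
      (kron q (u i * v i / v j) t) := by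
  have hn : ‖u i * v i / v j‖ = ‖u i‖ * r i / r j := by
    rw [norm_div, norm_mul, hv, hv]
  have hj := h.pos j
  have hi := h.pos i
  have hq0 : 0 < ‖q‖ := norm_pos_iff.2 h0
  rcases lt_or_ge j i with hij | hij
  · simp only [hij, if_true]
    refine hasSum_kron_of_lt h0 h1 ht ?_ ?_
    · rw [hn, lt_div_iff₀ hj]
      have e1 := h.2.2.2 j i
      have e2 := h.2.1 j
      have e3 := h.2.1 i
      nlinarith
    · rw [hn, div_lt_one hj]
      exact h.2.2.1 j i hij
  · simp only [not_lt.2 hij, if_false, sub_zero]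
    refine hasSum_kron h0 h1 ht ?_ ?_
    · rw [hn, one_lt_div hj]
      rcases eq_or_lt_of_le hij with rfl | hlt
      · exact h.2.1 i
      · have e1 := h.2.2.1 i j hlt
        have e2 := h.2.1 j
        have e3 := h.2.1 i
        linarith
    · rw [hn, mul_div_assoc', div_lt_one hj]
      exact h.2.2.2 i j

/-- In the Leibniz expansion the term of σ and m is a monomial in v with exponents m_i - m_{σ⁻¹(i)}.
Its mean vanishes unless m is constant on the cycles of σ, and the sum over the remaining σ is the
determinant of `det_levels`. -/
theorem hasSum_torusMean_det {n : ℕ} {u : Fin n → ℂ} {r : Fin n → ℝ} (h : OmegaGW q u r)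
    (h0 : q ≠ 0) (h1 : ‖q‖ < 1) {t : ℂ} (ht : t ∈ fundStrip q) :
    HasSum (fun m : Fin n → ℤ => (∏ i, u i ^ m i) * ∏ k ∈ Finset.univ.image m, kronCoeff q k t)
      (torusMean (fun v => Matrix.det (Matrix.of fun i j => kron q (u i * v i / v j) t)) r) := by
  have hr := h.1
  let c : Fin n → Fin n → ℤ → ℂ := fun i j m => kronCoeff q m t - (if j < i then 1 else 0)
  let C : Equiv.Perm (Fin n) → (Fin n → ℤ) → ℂ := fun σ m =>
    ((Equiv.Perm.sign σ : ℤ) : ℂ) * ((∏ i, c i (σ i) (m i)) * ∏ i, u i ^ m i)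
  let e : Equiv.Perm (Fin n) → (Fin n → ℤ) → Fin n → ℤ := fun σ m i => m i - m (σ.symm i)
  let F : (Fin n → ℤ) → (Fin n → ℂ) → ℂ := fun m v => ∑ σ, C σ m * ∏ i, v i ^ e σ m i
  have hcont : ∀ σ m, Continuous fun θ : Fin n → ℝ =>
      C σ m * ∏ i, (torusMap 0 r θ i) ^ e σ m i := by
    intro σ m
    refine continuous_const.mul (continuous_finsetProd _ fun i _ => ?_)
    exact ((continuous_apply i).comp (continuous_torusMap r)).zpow₀ _
      fun θ => Or.inl (torusMap_ne_zero hr θ i)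
  have hterm : ∀ σ m θ, C σ m * ∏ i, (torusMap 0 r θ i) ^ e σ m i =
      ((Equiv.Perm.sign σ : ℤ) : ℂ) * ∏ i, (c i (σ i) (m i) *
        (u i * torusMap 0 r θ i / torusMap 0 r θ (σ i)) ^ m i) := by
    intro σ m θ
    have hne := torusMap_ne_zero hr θ
    have e1 : ∏ i, (torusMap 0 r θ i) ^ e σ m i =
        (∏ i, (torusMap 0 r θ i) ^ m i) / ∏ i, (torusMap 0 r θ (σ i)) ^ m i := by
      rw [← Equiv.prod_comp σ.symm fun i => (torusMap 0 r θ (σ i)) ^ m i, ← Finset.prod_div_distrib]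
      refine Finset.prod_congr rfl fun i _ => ?_
      rw [zpow_sub₀ (hne i)]
      simp
    rw [e1]
    simp only [C, div_zpow, mul_zpow, Finset.prod_mul_distrib, Finset.prod_div_distrib]
    ring
  have hsum : ∀ σ θ, HasSum (fun m => C σ m * ∏ i, (torusMap 0 r θ i) ^ e σ m i)
      (((Equiv.Perm.sign σ : ℤ) : ℂ) *
        ∏ i, kron q (u i * torusMap 0 r θ i / torusMap 0 r θ (σ i)) t) := by
    intro σ θ
    simp only [hterm]
    refine HasSum.mul_left _ (hasSum_prod_of_summable_norm (fun i m => c i (σ i) m *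
        (u i * torusMap 0 r θ i / torusMap 0 r θ (σ i)) ^ m) _ fun i => ?_)
    exact hasSum_kron_pair h h0 h1 ht (fun i => norm_torusMap hr θ i) i (σ i)
  -- Monomials have constant absolute value on the torus, so absolute convergence at θ = 0 supplies
  -- the dominating series.
  have hnorm : ∀ σ m θ, ‖C σ m * ∏ i, (torusMap 0 r θ i) ^ e σ m i‖ =
      ‖C σ m * ∏ i, (torusMap 0 r 0 i) ^ e σ m i‖ := by
    intro σ m θ
    simp only [norm_mul, norm_prod, norm_zpow, norm_torusMap hr]
  have key := hasSum_torusMean (r := r)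
    (fun v => Matrix.det (Matrix.of fun i j => kron q (u i * v i / v j) t)) F
    (fun m => ∑ σ, ‖C σ m * ∏ i, (torusMap 0 r 0 i) ^ e σ m i‖)
    (fun m => continuous_finsetSum _ fun σ _ => hcont σ m)
    (fun m θ => (norm_sum_le _ _).trans (Finset.sum_le_sum fun σ _ => (hnorm σ m θ).le))
    (summable_sum fun σ _ => (hsum σ 0).summable.norm)
    (fun θ => by
      rw [← Matrix.det_transpose, Matrix.det_apply']
      exact hasSum_sum fun σ _ => hsum σ θ)
  convert! key using 2 with m
  rw [← det_levels, ← Matrix.det_transpose, Matrix.det_apply', Finset.mul_sum]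
  simp only [F]
  rw [torusMean_sum _ _ fun σ => hcont σ m]
  refine Finset.sum_congr rfl fun σ _ => ?_
  rw [torusMean_const_mul, torusMean_monomial hr]
  simp only [Matrix.transpose_apply, Matrix.of_apply]
  split_ifs with he
  · have hm : ∀ i, m i = m (σ i) := by
      intro i
      have := congrFun he (σ i)
      simp only [e, Equiv.symm_apply_apply, Pi.zero_apply] at this
      omega
    simp only [← hm, if_true, C, c]
    ring
  · have : ∃ i, m i ≠ m (σ i) := by
      by_contra hcon
      push Not at hcon
      apply he
      funext i
      have := hcon (σ.symm i)
      simp only [Equiv.apply_symm_apply] at this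
      simp [e, this]
    obtain ⟨i, hi⟩ := this
    have hz : ∏ i, (if m i = m (σ i) then kronCoeff q (m i) t - (if σ i < i then (1 : ℂ) else 0)
        else 0) = 0 := Finset.prod_eq_zero (Finset.mem_univ i) (if_neg hi)
    rw [hz]
    simp

end

section

open Complex Filter Topology Real MeasureTheory

variable {q : ℂ}

theorem OmegaGW.one_lt_norm {n : ℕ} {u : Fin n → ℂ} {r : Fin n → ℝ} (h : OmegaGW q u r)
    (i : Fin n) : 1 < ‖u i‖ :=
  (lt_mul_iff_one_lt_left (h.1 i)).1 (h.2.1 i)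

/-- Telescoping along the ordering; k is the last index. Together with the single-annulus condition
it bounds the product of all |u_i| by 1/|q|. -/
theorem exists_prod_mul_le {n : ℕ} (a r : Fin (n + 1) → ℝ) (ha : ∀ i, 0 ≤ a i)
    (h : ∀ i j, i < j → a j * r j ≤ r i) : ∃ k, (∏ i, a i) * r k ≤ a 0 * r 0 := by
  induction n with
  | zero => exact ⟨0, by simp⟩
  | succ n ih =>
    obtain ⟨k, hk⟩ := ih (fun i => a i.succ) (fun i => r i.succ) (fun i => ha _)
      fun i j hij => h _ _ (Fin.succ_lt_succ_iff.2 hij)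
    refine ⟨k.succ, ?_⟩
    rw [Fin.prod_univ_succ, mul_assoc]
    exact mul_le_mul_of_nonneg_left (hk.trans (h 0 _ (Fin.succ_pos 0))) (ha 0)

theorem OmegaGW.prod_bounds {n : ℕ} {u : Fin n → ℂ} {r : Fin n → ℝ} (h : OmegaGW q u r)
    {B : Finset (Fin n)} (hB : B.Nonempty) :
    1 < ‖∏ i ∈ B, u i‖ ∧ ‖q‖ * ‖∏ i ∈ B, u i‖ < 1 := by
  have h1 : ∀ S : Finset (Fin n), 1 ≤ ‖∏ i ∈ S, u i‖ := fun S => by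
    rw [norm_prod]
    exact Finset.one_le_prod fun i _ => (h.one_lt_norm i).le
  obtain ⟨j, hj⟩ := hB
  constructor
  · rw [← Finset.mul_prod_erase _ _ hj, norm_mul]
    exact one_lt_mul_of_lt_of_le (h.one_lt_norm j) (h1 _)
  · obtain ⟨n, rfl⟩ : ∃ k, n = k + 1 := ⟨n - 1, by have := j.2; omega⟩
    obtain ⟨k, hk⟩ := exists_prod_mul_le (fun i => ‖u i‖) r (fun i => norm_nonneg _)
      fun i j hij => (h.2.2.1 i j hij).le
    have hle : ‖∏ i ∈ B, u i‖ ≤ ∏ i, ‖u i‖ := by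
      rw [← norm_prod, ← Finset.prod_mul_prod_compl B, norm_mul]
      exact le_mul_of_one_le_right (norm_nonneg _) (h1 _)
    have h3 := h.2.2.2 0 k
    have h4 := h.1 k
    have h5 : ‖q‖ * (∏ i, ‖u i‖) * r k < 1 * r k := by
      rw [one_mul, mul_assoc]
      exact lt_of_le_of_lt (mul_le_mul_of_nonneg_left hk (norm_nonneg q)) h3
    exact lt_of_le_of_lt (mul_le_mul_of_nonneg_left hle (norm_nonneg q))
      (lt_of_mul_lt_mul_right h5 h4.le)

/-- Frobenius' formula has the prefactor θ(t + Z)/θ(t), where Z = ∑(P_i - Q_i) = ∑ log u_k is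
independent of v. It equals κ(∏u, t) times the θ(Z) already present in the integrand. -/
theorem kron_mul_cycleIntegral {n : ℕ} (hn : 1 ≤ n) {u : Fin n → ℂ} {r : Fin n → ℝ}
    (h : OmegaGW q u r) (h0 : q ≠ 0) (h1 : ‖q‖ < 1) {t : ℂ} (ht : t ∈ fundStrip q) :
    kron q (∏ i, u i) t * cycleIntegral q u r =
      torusMean (fun v => Matrix.det (Matrix.of fun i j => kron q (u i * v i / v j) t)) r := by
  have hu0 : ∀ i, u i ≠ 0 := fun i => norm_pos_iff.1 (zero_lt_one.trans (h.one_lt_norm i))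
  have hq0 : 0 < ‖q‖ := norm_pos_iff.2 h0
  rw [cycleIntegral, cycle_eq_torusMean _ h.1, ← torusMean_const_mul]
  refine torusMean_congr fun θ => ?_
  set v := torusMap 0 r θ with hvdef
  have hv : ∀ i, ‖v i‖ = r i := norm_torusMap h.1 θ
  have hv0 : ∀ i, v i ≠ 0 := torusMap_ne_zero h.1 θ
  have hexp : ∀ i j, exp (log (u i) + log (v i) - log (v j)) = u i * v i / v j := fun i j => by
    rw [Complex.exp_sub, Complex.exp_add, exp_log (hu0 i), exp_log (hv0 i), exp_log (hv0 j)]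
  have hθt : theta q t ≠ 0 := (theta_ne_zero_iff h1 t).2 (phi_exp_ne_zero h1 ht)
  have hPQ : ∀ i j, theta q (log (u i) + log (v i) - log (v j)) ≠ 0 := by
    intro i j
    rw [theta_ne_zero_iff h1, hexp]
    have hn : ‖u i * v i / v j‖ = ‖u i‖ * r i / r j := by
      rw [norm_div, norm_mul, hv, hv]
    have hj := h.pos j
    have hi := h.pos i
    rcases lt_or_ge j i with hij | hij
    · have hlt : ‖u i * v i / v j‖ < 1 := by
        rw [hn, div_lt_one hj]
        exact h.2.2.1 j i hij
      refine phi_ne_zero h1 ?_ (by nlinarith) fun hh => ?_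
      · rw [hn, lt_div_iff₀ hj]
        have e1 := h.2.2.2 j i
        have e2 := h.2.1 j
        have e3 := h.2.1 i
        nlinarith
      · rw [hh, norm_one] at hlt
        exact lt_irrefl _ hlt
    · refine phi_ne_zero_of_one_lt h1 ?_ ?_
      · rw [hn, one_lt_div hj]
        rcases eq_or_lt_of_le hij with rfl | hlt
        · exact h.2.1 i
        · have e1 := h.2.2.1 i j hlt
          have e2 := h.2.1 j
          have e3 := h.2.1 i
          linarith
      · rw [hn, mul_div_assoc', div_lt_one hj]
        exact h.2.2.2 i j
  have hdet := det_theta h0 h1 (fun i => log (u i) + log (v i)) (fun j => log (v j)) t hPQ hθt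
  simp only [theta_div_eq_kron h1, hexp] at hdet
  rw [hdet, integrand]
  have hZ : exp (∑ k, log (u k)) = ∏ k, u k := by
    rw [Complex.exp_sum]
    exact Finset.prod_congr rfl fun i _ => exp_log (hu0 i)
  have hb := h.prod_bounds (B := Finset.univ) ⟨⟨0, hn⟩, Finset.mem_univ _⟩
  have hθZ : theta q (∑ k, log (u k)) ≠ 0 := by
    rw [theta_ne_zero_iff h1, hZ]
    exact phi_ne_zero_of_one_lt h1 hb.1 hb.2
  rw [← hZ, ← theta_div_eq_kron h1]
  have e : ∑ i, (log (u i) + log (v i) - log (v i)) = ∑ k, log (u k) := by simp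
  rw [e, add_comm t]
  field_simp

end

/-! ### Sums over set partitions. -/

section

open Complex Filter Topology Real

/-- The sum over the set partitions of `s` of the products `∏_B κ_{|B|-1}(∏_{i ∈ B} u_i)`, built by
splitting off the block of the smallest element. -/
noncomputable def moment {ι : Type*} [LinearOrder ι] (κ : ℕ → ℂ → ℂ) (u : ι → ℂ)
    (s : Finset ι) : ℂ :=
  if h : s.Nonempty then
    ∑ J ∈ (s.erase (s.min' h)).powerset.attach, κ J.1.card (u (s.min' h) * ∏ i ∈ J.1, u i) *
      moment κ u (s.erase (s.min' h) \ J.1)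
  else 1
termination_by s.card
decreasing_by
  exact lt_of_le_of_lt (Finset.card_le_card Finset.sdiff_subset)
    (Finset.card_erase_lt_of_mem (s.min'_mem h))

section
variable {ι : Type*} [LinearOrder ι] (κ : ℕ → ℂ → ℂ) (u : ι → ℂ)

theorem moment_empty : moment κ u ∅ = 1 := by
  rw [moment]; simp

theorem moment_insert {a : ι} {s : Finset ι} (h : ∀ i ∈ s, a < i) :
    moment κ u (insert a s) =
      ∑ J ∈ s.powerset, κ J.card (u a * ∏ i ∈ J, u i) * moment κ u (s \ J) := by
  have hne : (insert a s).Nonempty := Finset.insert_nonempty a s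
  have ha : a ∉ s := fun hh => lt_irrefl _ (h a hh)
  have hmin : (insert a s).min' hne = a := by
    refine le_antisymm (Finset.min'_le _ _ (Finset.mem_insert_self _ _)) ?_
    refine Finset.le_min' _ _ _ fun i hi => ?_
    rcases Finset.mem_insert.1 hi with rfl | hi
    · exact le_rfl
    · exact (h i hi).le
  rw [moment, dif_pos hne, Finset.sum_attach _ fun J =>
    κ J.card (u ((insert a s).min' hne) * ∏ i ∈ J, u i) *
      moment κ u ((insert a s).erase ((insert a s).min' hne) \ J), hmin, Finset.erase_insert ha]

/-- Induction on finite sets by adding a smallest element. -/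
theorem finset_induction_min {p : Finset ι → Prop} (h0 : p ∅)
    (hs : ∀ a s, (∀ i ∈ s, a < i) → (∀ t ⊆ s, p t) → p (insert a s)) (s : Finset ι) : p s := by
  induction s using Finset.strongInduction with
  | H s ih =>
    rcases s.eq_empty_or_nonempty with rfl | hne
    · exact h0
    · rw [← Finset.insert_erase (s.min'_mem hne)]
      refine hs _ _ (fun i hi => ?_) fun t ht => ?_
      · exact lt_of_le_of_ne (Finset.min'_le _ _ (Finset.mem_of_mem_erase hi))
          (Finset.ne_of_mem_erase hi).symm
      · exact ih t (lt_of_le_of_lt ht (Finset.erase_ssubset (s.min'_mem hne)))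

theorem moment_congr {u w : ι → ℂ} (s : Finset ι) (h : ∀ i ∈ s, u i = w i) :
    moment κ u s = moment κ w s := by
  induction s using finset_induction_min with
  | h0 => rw [moment_empty, moment_empty]
  | hs a s ha ih =>
    rw [moment_insert κ u ha, moment_insert κ w ha]
    refine Finset.sum_congr rfl fun J hJ => ?_
    have hJ' := Finset.mem_powerset.1 hJ
    rw [h a (Finset.mem_insert_self _ _),
      Finset.prod_congr rfl fun i hi => h i (Finset.mem_insert_of_mem (hJ' hi)),
      ih _ Finset.sdiff_subset fun i hi =>
        h i (Finset.mem_insert_of_mem (Finset.sdiff_subset hi))]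

theorem moment_map {ι' : Type*} [LinearOrder ι'] (f : ι' ↪o ι) (s : Finset ι') :
    moment κ (fun i => u (f i)) s = moment κ u (s.map f.toEmbedding) := by
  induction s using finset_induction_min with
  | h0 => simp [moment_empty]
  | hs a s ha ih =>
    rw [moment_insert κ _ ha, Finset.map_insert, moment_insert κ u]
    · have : (s.map f.toEmbedding).powerset =
          s.powerset.map ⟨fun J => J.map f.toEmbedding, Finset.map_injective _⟩ := by
        ext K
        simp only [Finset.mem_powerset, Finset.mem_map, Function.Embedding.coeFn_mk]
        constructor
        · intro hK
          obtain ⟨J, hJ, rfl⟩ := Finset.subset_map_iff.1 hK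
          exact ⟨J, hJ, rfl⟩
        · rintro ⟨J, hJ, rfl⟩
          exact Finset.map_subset_map.2 hJ
      rw [this, Finset.sum_map]
      refine Finset.sum_congr rfl fun J hJ => ?_
      simp only [Function.Embedding.coeFn_mk, Finset.card_map, Finset.prod_map]
      rw [ih _ Finset.sdiff_subset, Finset.map_sdiff]
      rfl
    · intro i hi
      obtain ⟨j, hj, rfl⟩ := Finset.mem_map.1 hi
      exact f.lt_iff_lt.2 (ha j hj)

theorem sum_powerset_powerset {α : Type*} [DecidableEq α] (s : Finset α)
    (f : Finset α → Finset α → ℂ) :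
    ∑ J ∈ s.powerset, ∑ I ∈ J.powerset, f J I =
      ∑ I ∈ s.powerset, ∑ J ∈ (s \ I).powerset, f (I ∪ J) I := by
  rw [Finset.sum_comm' (t' := s.powerset) (s' := fun I => s.powerset.filter (I ⊆ ·))]
  · refine Finset.sum_congr rfl fun I hI => ?_
    rw [Finset.mem_powerset] at hI
    refine Finset.sum_bij' (fun J _ => J \ I) (fun J _ => I ∪ J) ?_ ?_ ?_ ?_ ?_
    · intro J hJ
      simp only [Finset.mem_filter, Finset.mem_powerset] at hJ ⊢
      exact Finset.sdiff_subset_sdiff hJ.1 le_rfl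
    · intro J hJ
      simp only [Finset.mem_filter, Finset.mem_powerset] at hJ ⊢
      exact ⟨Finset.union_subset hI (hJ.trans Finset.sdiff_subset), Finset.subset_union_left⟩
    · intro J hJ
      simp only [Finset.mem_filter, Finset.mem_powerset] at hJ
      exact Finset.union_sdiff_of_subset hJ.2
    · intro J hJ
      simp only [Finset.mem_powerset] at hJ
      rw [Finset.union_sdiff_cancel_left]
      exact Finset.disjoint_of_subset_right hJ Finset.disjoint_sdiff
    · intro J hJ
      simp only [Finset.mem_filter, Finset.mem_powerset] at hJ
      rw [Finset.union_sdiff_of_subset hJ.2]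
  · intro J I
    simp only [Finset.mem_powerset, Finset.mem_filter]
    exact ⟨fun h => ⟨⟨h.1, h.2⟩, h.2.trans h.1⟩, fun h => ⟨h.1.1, h.1.2⟩⟩

/-- The `q`-difference equation for `moment`, from the one for `κ`. -/
theorem moment_update {b q : ℂ} {a : ι} {s : Finset ι} (ha : ∀ i ∈ s, a < i)
    (hκ : ∀ J ⊆ s, ∀ k, κ k (q * (u a * ∏ i ∈ J, u i)) = b *
      ∑ j ∈ Finset.range (k + 1), (k.choose j : ℂ) * ((-1) ^ j * κ (k - j) (u a * ∏ i ∈ J, u i))) :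
    moment κ (Function.update u a (q * u a)) (insert a s) =
      b * ∑ I ∈ s.powerset, (-1) ^ I.card *
        moment κ (Function.update u a (u a * ∏ i ∈ I, u i)) (insert a (s \ I)) := by
  have hne : ∀ i ∈ s, i ≠ a := fun i hi => (ha i hi).ne'
  have hupd : ∀ (c : ℂ) (S : Finset ι), S ⊆ s →
      ∏ i ∈ S, Function.update u a c i = ∏ i ∈ S, u i := fun c S hS =>
    Finset.prod_congr rfl fun i hi => Function.update_of_ne (hne i (hS hi)) _ _
  have hmom : ∀ (c : ℂ) (S : Finset ι), S ⊆ s →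
      moment κ (Function.update u a c) S = moment κ u S := fun c S hS =>
    moment_congr κ S fun i hi => Function.update_of_ne (hne i (hS hi)) _ _
  rw [moment_insert κ _ ha]
  -- The binomial coefficient counts the subsets I of J of given size. After exchanging the sums
  -- over I ⊆ J, the set J \ I is the rest of the block of a once u_a has absorbed u_I.
  have hL : ∀ J ∈ s.powerset, κ J.card (Function.update u a (q * u a) a *
      ∏ i ∈ J, Function.update u a (q * u a) i) * moment κ (Function.update u a (q * u a)) (s \ J) =
      ∑ I ∈ J.powerset, b * ((-1) ^ I.card *
        (κ (J.card - I.card) (u a * ∏ i ∈ J, u i) * moment κ u (s \ J))) := by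
    intro J hJ
    have hJ' := Finset.mem_powerset.1 hJ
    rw [hupd _ _ hJ', hmom _ _ Finset.sdiff_subset, Function.update_self, mul_assoc q,
      hκ J hJ', Finset.sum_powerset_apply_card (fun c => b * ((-1) ^ c *
        (κ (J.card - c) (u a * ∏ i ∈ J, u i) * moment κ u (s \ J)))), mul_assoc, Finset.sum_mul,
      Finset.mul_sum]
    refine Finset.sum_congr rfl fun j _ => ?_
    rw [nsmul_eq_mul]
    ring
  rw [Finset.sum_congr rfl hL, sum_powerset_powerset, Finset.mul_sum]
  refine Finset.sum_congr rfl fun I hI => ?_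
  have hI' := Finset.mem_powerset.1 hI
  rw [moment_insert κ _ fun i hi => ha i (Finset.sdiff_subset hi), Finset.mul_sum, Finset.mul_sum]
  refine Finset.sum_congr rfl fun J hJ => ?_
  have hJ' := Finset.mem_powerset.1 hJ
  have hdisj : Disjoint I J := Finset.disjoint_of_subset_right hJ' Finset.disjoint_sdiff
  rw [hupd _ _ (hJ'.trans Finset.sdiff_subset),
    hmom _ _ (Finset.sdiff_subset.trans Finset.sdiff_subset), Function.update_self,
    Finset.card_union_of_disjoint hdisj, Finset.prod_union hdisj, Nat.add_sub_cancel_left,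
    mul_assoc, sdiff_sdiff_left]
  rfl

end

end

/-! ### The Laurent series of the partition sum. -/

section

open Complex Filter Topology Real

section
variable {ι : Type*} [LinearOrder ι]

open Classical in
/-- The term with exponents `m` in the Laurent expansion of `moment`. -/
noncomputable def momentTerm (p : ℕ → ℤ → ℂ) (u : ι → ℂ) (s : Finset ι) (m : ι → ℤ) : ℂ :=
  if ∀ i, i ∉ s → m i = 0 then (∏ i ∈ s, u i ^ m i) * ∏ k ∈ s.image m, p 0 k else 0

open Classical in
/-- The part of `momentTerm` in which `J` is added to the block of `a`. -/
noncomputable def blockTerm (p : ℕ → ℤ → ℂ) (u : ι → ℂ) (a : ι) (s J : Finset ι) (m : ι → ℤ) : ℂ :=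
  if (∀ i, i ∉ insert a s → m i = 0) ∧ ∀ i ∈ J, m i = m a then
    (p J.card (m a) * ∏ i ∈ insert a s, u i ^ m i) * ∏ k ∈ (s \ J).image m, p 0 k else 0

/-- Let L be the set of indices in s on the level of a. Only J ⊆ L contribute, and the level m a
survives in s \ J, giving another factor p_0, unless J = L. The sum over J is thus p_l + p_0 ∑_{j<l}
C(l,j) p_j with l = |L|, which `hp` identifies with the single factor p_0. -/
theorem sum_blockTerm {p : ℕ → ℤ → ℂ} (hp : ∀ m l, p 0 m = p l m + p 0 m *
      ∑ j ∈ Finset.range l, (l.choose j : ℂ) * p j m) (u : ι → ℂ) (a : ι) (s : Finset ι)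
    (m : ι → ℤ) :
    ∑ J ∈ s.powerset, blockTerm p u a s J m = momentTerm p u (insert a s) m := by
  classical
  by_cases hm : ∀ i, i ∉ insert a s → m i = 0
  swap
  · simp only [blockTerm, momentTerm, hm, false_and, if_false, Finset.sum_const_zero]
  set L := s.filter fun i => m i = m a with hL
  set R := (s \ L).image m with hR
  have haR : m a ∉ R := by
    intro h
    obtain ⟨i, hi, hia⟩ := Finset.mem_image.1 h
    rw [Finset.mem_sdiff, hL, Finset.mem_filter] at hi
    exact hi.2 ⟨hi.1, hia⟩
  have himg : (insert a s).image m = insert (m a) R := by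
    ext k
    simp only [hR, hL, Finset.mem_image, Finset.mem_insert, Finset.mem_sdiff, Finset.mem_filter]
    constructor
    · rintro ⟨i, rfl | hi, rfl⟩
      · exact Or.inl rfl
      · by_cases h : m i = m a
        · exact Or.inl h
        · exact Or.inr ⟨i, ⟨hi, fun h' => h h'.2⟩, rfl⟩
    · rintro (rfl | ⟨i, hi, rfl⟩)
      · exact ⟨a, Or.inl rfl, rfl⟩
      · exact ⟨i, Or.inr hi.1, rfl⟩
  have hJ : ∀ J ⊆ L, ∏ k ∈ (s \ J).image m, p 0 k =
      (if J.card = L.card then 1 else p 0 (m a)) * ∏ k ∈ R, p 0 k := by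
    intro J hJ
    split_ifs with hc
    · rw [Finset.eq_of_subset_of_card_le hJ hc.ge, one_mul]
    · have hne : ∃ i ∈ L, i ∉ J := by
        by_contra hcon
        push Not at hcon
        exact hc (congrArg Finset.card (hJ.antisymm hcon))
      obtain ⟨i, hiL, hiJ⟩ := hne
      rw [← Finset.prod_insert haR]
      congr 1
      ext k
      simp only [hR, hL, Finset.mem_image, Finset.mem_insert, Finset.mem_sdiff, Finset.mem_filter]
      rw [hL, Finset.mem_filter] at hiL
      constructor
      · rintro ⟨x, hx, rfl⟩
        by_cases h : m x = m a
        · exact Or.inl h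
        · exact Or.inr ⟨x, ⟨hx.1, fun h' => h h'.2⟩, rfl⟩
      · rintro (rfl | ⟨x, hx, rfl⟩)
        · exact ⟨i, ⟨hiL.1, hiJ⟩, hiL.2⟩
        · refine ⟨x, ⟨hx.1, fun h => hx.2 ?_⟩, rfl⟩
          have := hJ h
          rwa [hL, Finset.mem_filter] at this
  have hsub : ∑ J ∈ s.powerset, blockTerm p u a s J m =
      ∑ J ∈ L.powerset, (p J.card (m a) * if J.card = L.card then 1 else p 0 (m a)) *
        ((∏ i ∈ insert a s, u i ^ m i) * ∏ k ∈ R, p 0 k) := by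
    rw [← Finset.sum_subset (Finset.powerset_mono.2 (Finset.filter_subset (fun i => m i = m a) s))]
    · refine Finset.sum_congr rfl fun J hJL => ?_
      have hJL' := Finset.mem_powerset.1 hJL
      have hcond : ∀ i ∈ J, m i = m a := fun i hi => (Finset.mem_filter.1 (hJL' hi)).2
      rw [blockTerm, if_pos ⟨hm, hcond⟩, hJ J hJL']
      ring
    · intro J hJs hJL
      rw [blockTerm, if_neg]
      rintro ⟨-, h⟩
      refine hJL (Finset.mem_powerset.2 fun i hi => Finset.mem_filter.2 ⟨?_, h i hi⟩)
      exact Finset.mem_powerset.1 hJs hi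
  rw [hsub, ← Finset.sum_mul, Finset.sum_powerset_apply_card (fun c => p c (m a) *
    if c = L.card then 1 else p 0 (m a)), Finset.sum_range_succ, momentTerm, if_pos hm, himg,
    Finset.prod_insert haR]
  have e : ∑ j ∈ Finset.range L.card, L.card.choose j • (p j (m a) *
      if j = L.card then 1 else p 0 (m a)) =
      p 0 (m a) * ∑ j ∈ Finset.range L.card, (L.card.choose j : ℂ) * p j (m a) := by
    rw [Finset.mul_sum]
    refine Finset.sum_congr rfl fun j hj => ?_
    rw [if_neg (Finset.mem_range.1 hj).ne, nsmul_eq_mul]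
    ring
  have h3 := hp (m a) L.card
  rw [e]
  simp only [if_true, mul_one, Nat.choose_self, one_smul]
  linear_combination -((∏ i ∈ insert a s, u i ^ m i) * ∏ k ∈ R, p 0 k) * h3

/-- The product of the two series is reindexed: a pair (k, m') corresponds to the exponent vector
equal to k on the block of a and to m' on s \ J. -/
theorem hasSum_blockTerm {p : ℕ → ℤ → ℂ} {u : ι → ℂ} {a : ι} {s J : Finset ι} (ha : a ∉ s)
    (hJ : J ⊆ s) {x y : ℂ}
    (hx : HasSum (fun k : ℤ => p J.card k * (u a * ∏ i ∈ J, u i) ^ k) x)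
    (hy : HasSum (momentTerm p u (s \ J)) y) : HasSum (blockTerm p u a s J) (x * y) := by
  classical
  have hmul := HasSum.mul (f := fun k : ℤ => p J.card k * (u a * ∏ i ∈ J, u i) ^ k)
    (g := momentTerm p u (s \ J)) hx hy (summable_mul_of_summable_norm
      (f := fun k : ℤ => p J.card k * (u a * ∏ i ∈ J, u i) ^ k)
      (g := momentTerm p u (s \ J)) hx.summable.norm hy.summable.norm)
  set G : ℤ × (ι → ℤ) → ℂ := fun z => p J.card z.1 * (u a * ∏ i ∈ J, u i) ^ z.1 *
    momentTerm p u (s \ J) z.2 with hG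
  have haJ : a ∉ J := fun h => ha (hJ h)
  let Φ : ℤ × (ι → ℤ) → ι → ℤ := fun z i => if i = a ∨ i ∈ J then z.1 else z.2 i
  let Ψ : (ι → ℤ) → ℤ × (ι → ℤ) := fun m => (m a, fun i => if i ∈ s \ J then m i else 0)
  have hGsupp : ∀ z, G z ≠ 0 → ∀ i, i ∉ s \ J → z.2 i = 0 := by
    intro z hz
    by_contra hcon
    exact hz (by simp only [hG, momentTerm, if_neg hcon, mul_zero])
  have hΨΦ : ∀ z : ℤ × (ι → ℤ), (∀ i, i ∉ s \ J → z.2 i = 0) → Ψ (Φ z) = z := by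
    intro z hz
    refine Prod.ext (by simp [Ψ, Φ]) (funext fun i => ?_)
    simp only [Ψ, Φ]
    by_cases hi : i ∈ s \ J
    · have h1 : i ≠ a := by
        rintro rfl
        exact ha (Finset.mem_sdiff.1 hi).1
      rw [if_pos hi, if_neg]
      rintro (h | h)
      · exact h1 h
      · exact (Finset.mem_sdiff.1 hi).2 h
    · rw [if_neg hi, hz i hi]
  have hcond : ∀ z : ℤ × (ι → ℤ), (∀ i, i ∉ s \ J → z.2 i = 0) →
      (∀ i, i ∉ insert a s → Φ z i = 0) ∧ ∀ i ∈ J, Φ z i = Φ z a := by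
    intro z hz
    refine ⟨fun i hi => ?_, fun i hi => ?_⟩
    · rw [Finset.mem_insert, not_or] at hi
      simp only [Φ]
      rw [if_neg, hz i fun h => hi.2 (Finset.mem_sdiff.1 h).1]
      rintro (h | h)
      · exact hi.1 h
      · exact hi.2 (hJ h)
    · simp [Φ, hi]
  have hTG : ∀ m : ι → ℤ, ((∀ i, i ∉ insert a s → m i = 0) ∧ ∀ i ∈ J, m i = m a) →
      blockTerm p u a s J m = G (Ψ m) := by
    intro m hm
    rw [blockTerm, if_pos hm]
    simp only [hG, Ψ]
    rw [momentTerm, if_pos fun i hi => if_neg hi, Finset.prod_insert ha, ← Finset.prod_sdiff hJ,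
      mul_zpow, ← Finset.prod_zpow]
    have e1 : ∏ i ∈ J, u i ^ m i = ∏ i ∈ J, u i ^ m a :=
      Finset.prod_congr rfl fun i hi => by rw [hm.2 i hi]
    have e2 : ∏ i ∈ s \ J, u i ^ (if i ∈ s \ J then m i else 0) = ∏ i ∈ s \ J, u i ^ m i :=
      Finset.prod_congr rfl fun i hi => by rw [if_pos hi]
    have e3 : (s \ J).image (fun i => if i ∈ s \ J then m i else 0) = (s \ J).image m :=
      Finset.image_congr fun i hi => if_pos hi
    rw [e1, e2, e3]
    ring
  refine (hasSum_iff_hasSum_of_ne_zero_bij (g := G) (fun z => Φ z.1) ?_ ?_ ?_).2 hmul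
  · intro z w hzw
    have h1 := hΨΦ z.1 (hGsupp _ z.2)
    have h2 := hΨΦ w.1 (hGsupp _ w.2)
    refine Subtype.ext ?_
    rw [← h1, ← h2]
    exact congrArg Ψ hzw
  · intro m hm
    have hc : (∀ i, i ∉ insert a s → m i = 0) ∧ ∀ i ∈ J, m i = m a := by
      by_contra hcon
      exact hm (by simp only [blockTerm, if_neg hcon])
    refine ⟨⟨Ψ m, ?_⟩, funext fun i => ?_⟩
    · rw [Function.mem_support, ← hTG m hc]
      exact hm
    · simp only [Φ, Ψ]
      split_ifs with h1 h2
      · rcases h1 with rfl | h1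
        · rfl
        · exact (hc.2 i h1).symm
      · rfl
      · refine (hc.1 i ?_).symm
        rw [Finset.mem_insert, not_or]
        rw [not_or] at h1
        exact ⟨h1.1, fun h => h2 (Finset.mem_sdiff.2 ⟨h, h1.2⟩)⟩
  · intro z
    have hz := hGsupp _ z.2
    rw [hTG _ (hcond _ hz), hΨΦ _ hz]

theorem hasSum_moment {p : ℕ → ℤ → ℂ} {κ : ℕ → ℂ → ℂ} (hp : ∀ m l, p 0 m = p l m + p 0 m *
      ∑ j ∈ Finset.range l, (l.choose j : ℂ) * p j m) {u : ι → ℂ}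
    (hκ : ∀ B : Finset ι, B.Nonempty → ∀ k,
      HasSum (fun m : ℤ => p k m * (∏ i ∈ B, u i) ^ m) (κ k (∏ i ∈ B, u i))) (s : Finset ι) :
    HasSum (momentTerm p u s) (moment κ u s) := by
  induction s using finset_induction_min with
  | h0 =>
    classical
    have h : momentTerm p u ∅ = fun m => if m = 0 then 1 else 0 := by
      funext m
      simp [momentTerm, funext_iff]
    rw [moment_empty, h]
    exact hasSum_ite_eq 0 1
  | hs a s ha ih =>
    have has : a ∉ s := fun h => lt_irrefl _ (ha a h)
    rw [moment_insert κ u ha]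
    have h : momentTerm p u (insert a s) =
        fun m => ∑ J ∈ s.powerset, blockTerm p u a s J m :=
      funext fun m => (sum_blockTerm hp u a s m).symm
    rw [h]
    refine hasSum_sum fun J hJ => ?_
    have hJ' := Finset.mem_powerset.1 hJ
    refine hasSum_blockTerm has hJ' ?_ (ih _ Finset.sdiff_subset)
    have := hκ (insert a J) (Finset.insert_nonempty a J) J.card
    rwa [Finset.prod_insert fun h => has (hJ' h)] at this

end

end

/-! ### Derivatives of the Kronecker function in t. -/

section

open Complex Filter Topology

variable {q : ℂ}

/-- Uniformity in t is what permits termwise differentiation in t later on. -/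
theorem tendstoLocallyUniformlyOn_kron (h0 : q ≠ 0) (h1 : ‖q‖ < 1) {U : ℂ}
    (hU : 1 < ‖U‖) (hU' : ‖q‖ * ‖U‖ < 1) :
    TendstoLocallyUniformlyOn (fun (S : Finset ℤ) t => ∑ m ∈ S, kronCoeff q m t * U ^ m)
      (fun t => kron q U t) atTop (fundStrip q) := by
  intro ε hε t ht
  have ht0 : ∀ s : ℂ, ‖exp s‖ ≠ 0 := fun s => norm_ne_zero_iff.2 (exp_ne_zero s)
  have hc1 : ContinuousAt (fun s : ℂ => (1 - ‖exp s‖)⁻¹) t :=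
    ContinuousAt.inv₀ (by fun_prop) (by linarith [ht.2])
  have hc2 : ContinuousAt (fun s : ℂ => (1 - ‖q‖ / ‖exp s‖)⁻¹) t := by
    refine ContinuousAt.inv₀ (continuousAt_const.sub
      (ContinuousAt.div continuousAt_const (by fun_prop) (ht0 t))) ?_
    have := (div_lt_one (norm_pos_iff.2 (exp_ne_zero t))).2 ht.1
    linarith
  -- The slack 1 makes the geometric bounds valid on a whole neighbourhood of t.
  set C1 := (1 - ‖exp t‖)⁻¹ + 1
  set C2 := (1 - ‖q‖ / ‖exp t‖)⁻¹ + 1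
  let W : Set ℂ := {s | s ∈ fundStrip q ∧ (1 - ‖exp s‖)⁻¹ ≤ C1 ∧ (1 - ‖q‖ / ‖exp s‖)⁻¹ ≤ C2}
  have hW : W ∈ 𝓝 t := by
    filter_upwards [isOpen_fundStrip.mem_nhds ht, hc1.eventually_lt_const (lt_add_one _),
      hc2.eventually_lt_const (lt_add_one _)] with s hs hs1 hs2
    exact ⟨hs, hs1.le, hs2.le⟩
  let b : ℤ → ℝ := fun m => if 0 ≤ m then C1 * (‖q‖ * ‖U‖) ^ m.toNat
    else C2 * (‖U‖⁻¹) ^ (-m).toNat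
  have hb : Summable b := by
    refine Summable.of_nat_of_neg_add_one ?_ ?_
    · refine ((summable_geometric_of_lt_one (by positivity) hU').mul_left C1).congr fun k => ?_
      simp [b]
    · refine (((summable_nat_add_iff 1).2 (summable_geometric_of_lt_one
        (inv_nonneg.2 (norm_nonneg U)) (inv_lt_one_of_one_lt₀ hU))).mul_left C2).congr fun k => ?_
      have e : ¬ (0 : ℤ) ≤ -((k : ℤ) + 1) := by omega
      have e2 : (- -((k : ℤ) + 1)).toNat = k + 1 := by omega
      simp only [b]
      rw [if_neg e, e2]
  have hbound : ∀ (m : ℤ) (s : ℂ), s ∈ W → ‖kronCoeff q m s * U ^ m‖ ≤ b m := by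
    intro m s hs
    by_cases hm : 0 ≤ m
    · obtain ⟨k, rfl⟩ := Int.eq_ofNat_of_zero_le hm
      have := norm_kronCoeff_nat_le h1 hs.1 k U
      simp only [b, hm, if_true, Int.toNat_natCast]
      rw [zpow_natCast]
      refine this.trans ?_
      gcongr
      exact hs.2.1
    · obtain ⟨k, rfl⟩ : ∃ k : ℕ, m = -((k : ℤ) + 1) := ⟨(-m - 1).toNat, by omega⟩
      have := norm_kronCoeff_neg_le h0 h1 hs.1 k U
      have e2 : (- -((k : ℤ) + 1)).toNat = k + 1 := by omega
      simp only [b]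
      rw [if_neg hm, e2]
      refine this.trans ?_
      gcongr
      exact hs.2.2
  have hunif := (tendstoUniformlyOn_tsum hb hbound).congr_right
    (g := fun t => kron q U t) fun s hs => (hasSum_kron h0 h1 hs.1 hU hU').tsum_eq
  exact ⟨W, mem_nhdsWithin_of_mem_nhds hW, hunif ε hε⟩

theorem analyticAt_kronCoeff (h0 : q ≠ 0) (h1 : ‖q‖ < 1) (m : ℤ) {t : ℂ} (ht : t ∈ fundStrip q) :
    AnalyticAt ℂ (kronCoeff q m) t := by
  refine AnalyticAt.div ?_ ?_ (one_sub_ne_zero h0 h1 ht m)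
  · exact (analyticAt_cexp.mul analyticAt_const).neg
  · exact analyticAt_const.sub (analyticAt_cexp.mul analyticAt_const)

theorem analyticAt_iteratedDeriv {f : ℂ → ℂ} {t : ℂ} (h : AnalyticAt ℂ f t) (k : ℕ) :
    AnalyticAt ℂ (iteratedDeriv k f) t := by
  rw [iteratedDeriv_eq_iterate]
  exact h.iterated_deriv k

/-- The derivatives of the Kronecker function in the second variable. -/
noncomputable def kronDeriv (q t : ℂ) (k : ℕ) (U : ℂ) : ℂ :=
  iteratedDeriv k (fun s => kron q U s) t

theorem tendstoLocallyUniformlyOn_kronDeriv (h0 : q ≠ 0) (h1 : ‖q‖ < 1) {U : ℂ}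
    (hU : 1 < ‖U‖) (hU' : ‖q‖ * ‖U‖ < 1) (k : ℕ) :
    TendstoLocallyUniformlyOn
      (fun (S : Finset ℤ) t => ∑ m ∈ S, iteratedDeriv k (kronCoeff q m) t * U ^ m)
      (fun t => kronDeriv q t k U) atTop (fundStrip q) := by
  induction k with
  | zero =>
    simpa only [iteratedDeriv_zero, kronDeriv] using tendstoLocallyUniformlyOn_kron h0 h1 hU hU'
  | succ k ih =>
    have han : ∀ m : ℤ, ∀ t ∈ fundStrip q,
        DifferentiableAt ℂ (iteratedDeriv k (kronCoeff q m)) t := fun m t ht =>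
      (analyticAt_iteratedDeriv (analyticAt_kronCoeff h0 h1 m ht) k).differentiableAt
    have hd := ih.deriv (Eventually.of_forall fun S => DifferentiableOn.fun_sum fun m _ t ht =>
      ((han m t ht).mul_const _).differentiableWithinAt) isOpen_fundStrip
    have e : deriv (fun t => kronDeriv q t k U) = fun t => kronDeriv q t (k + 1) U := by
      funext t
      simp only [kronDeriv]
      rw [iteratedDeriv_succ]
    rw [e] at hd
    refine hd.congr fun S t ht => ?_
    simp only [Function.comp_apply]
    rw [deriv_fun_sum fun m _ => (han m t ht).mul_const _]
    refine Finset.sum_congr rfl fun m _ => ?_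
    rw [deriv_mul_const (han m t ht), iteratedDeriv_succ]

theorem hasSum_kronDeriv (h0 : q ≠ 0) (h1 : ‖q‖ < 1) {U t : ℂ} (ht : t ∈ fundStrip q)
    (hU : 1 < ‖U‖) (hU' : ‖q‖ * ‖U‖ < 1) (k : ℕ) :
    HasSum (fun m : ℤ => iteratedDeriv k (kronCoeff q m) t * U ^ m) (kronDeriv q t k U) :=
  (tendstoLocallyUniformlyOn_kronDeriv h0 h1 hU hU' k).tendsto_at ht

/-- The function x = e^t q^m is its own derivative, and p - xp = -x. Differentiating l times by
Leibniz and dividing by 1 - x gives the recursion required in `sum_blockTerm`. -/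
theorem iteratedDeriv_kronCoeff (h0 : q ≠ 0) (h1 : ‖q‖ < 1) {t : ℂ} (ht : t ∈ fundStrip q)
    (m : ℤ) (l : ℕ) : iteratedDeriv 0 (kronCoeff q m) t = iteratedDeriv l (kronCoeff q m) t +
      iteratedDeriv 0 (kronCoeff q m) t *
        ∑ j ∈ Finset.range l, (l.choose j : ℂ) * iteratedDeriv j (kronCoeff q m) t := by
  have hexp : ∀ j, iteratedDeriv j (fun s : ℂ => exp s * q ^ m) t = exp t * q ^ m := by
    intro j
    rw [iteratedDeriv_mul_const_field]
    have := congrFun (iteratedDeriv_cexp_const_mul j 1) t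
    simp only [one_mul, one_pow] at this
    rw [this]
  have hcx : ContDiffAt ℂ l (fun s : ℂ => exp s * q ^ m) t := by fun_prop
  have hcp : ContDiffAt ℂ l (kronCoeff q m) t := (analyticAt_kronCoeff h0 h1 m ht).contDiffAt
  have hev : (fun s => kronCoeff q m s - exp s * q ^ m * kronCoeff q m s) =ᶠ[𝓝 t]
      fun s => -(exp s * q ^ m) := by
    filter_upwards [isOpen_fundStrip.mem_nhds ht] with s hs
    have := one_sub_ne_zero h0 h1 hs m
    rw [kronCoeff]
    field_simp
    ring
  have key := hev.iteratedDeriv_eq l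
  rw [iteratedDeriv_fun_sub hcp (hcx.mul hcp), iteratedDeriv_fun_mul hcx hcp,
    iteratedDeriv_fun_neg, hexp, ← Finset.sum_range_reflect] at key
  have e : ∑ j ∈ Finset.range (l + 1), ((l.choose (l + 1 - 1 - j) : ℕ) : ℂ) *
      iteratedDeriv (l + 1 - 1 - j) (fun s : ℂ => exp s * q ^ m) t *
      iteratedDeriv (l - (l + 1 - 1 - j)) (kronCoeff q m) t =
      exp t * q ^ m * ∑ j ∈ Finset.range (l + 1),
        (l.choose j : ℂ) * iteratedDeriv j (kronCoeff q m) t := by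
    rw [Finset.mul_sum]
    refine Finset.sum_congr rfl fun j hj => ?_
    have hjl : j ≤ l := Nat.lt_succ_iff.1 (Finset.mem_range.1 hj)
    rw [hexp, Nat.add_sub_cancel, Nat.choose_symm hjl, Nat.sub_sub_self hjl]
    ring
  rw [e, Finset.sum_range_succ, Nat.choose_self, Nat.cast_one, one_mul] at key
  have hne := one_sub_ne_zero h0 h1 ht m
  rw [iteratedDeriv_zero]
  have hp : kronCoeff q m t * (1 - exp t * q ^ m) = -(exp t * q ^ m) := by
    rw [kronCoeff]; field_simp
  refine mul_right_cancel₀ hne ?_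
  rw [hp, add_mul, mul_right_comm, hp]
  linear_combination -key

theorem analyticAt_phi_mul_exp (h1 : ‖q‖ < 1) {U : ℂ} (hU : U ≠ 0) (t : ℂ) :
    AnalyticAt ℂ (fun s => phi q (U * exp s)) t := by
  refine AnalyticAt.comp (g := phi q) (f := fun s => U * exp s)
    (analyticAt_phi h1 (mul_ne_zero hU (exp_ne_zero t))) ?_
  exact analyticAt_const.mul analyticAt_cexp

theorem analyticAt_kron (h1 : ‖q‖ < 1) {U t : ℂ} (hU : U ≠ 0) (ht : phi q (exp t) ≠ 0) :
    AnalyticAt ℂ (fun s => kron q U s) t := by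
  have e : (fun s => kron q U s) = fun s => (phi q U)⁻¹ * (phi q (U * exp s) / phi q (exp s)) := by
    funext s
    rw [kron, div_mul_eq_div_div_swap, div_eq_mul_inv, mul_comm]
  rw [e]
  refine analyticAt_const.mul ((analyticAt_phi_mul_exp h1 hU t).div ?_ ht)
  simpa using analyticAt_phi_mul_exp h1 one_ne_zero t

theorem kronDeriv_mul_q (h0 : q ≠ 0) (h1 : ‖q‖ < 1) {U t : ℂ} (hU : U ≠ 0)
    (ht : phi q (exp t) ≠ 0) (k : ℕ) :
    kronDeriv q t k (q * U) = exp (-t) * ∑ j ∈ Finset.range (k + 1), (k.choose j : ℂ) *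
      ((-1) ^ j * kronDeriv q t (k - j) U) := by
  have e : (fun s => kron q (q * U) s) = fun s => exp (-1 * s) * kron q U s := by
    funext s
    rw [kron_mul_q h0 h1 hU, neg_one_mul]
  rw [kronDeriv, e, iteratedDeriv_fun_mul (by fun_prop) (analyticAt_kron h1 hU ht).contDiffAt,
    Finset.mul_sum]
  refine Finset.sum_congr rfl fun j _ => ?_
  rw [congrFun (iteratedDeriv_cexp_const_mul j (-1)) t, kronDeriv, neg_one_mul]
  ring

/-- The iterates of `z d/dz` on `phi`. -/
noncomputable def phiEuler (q : ℂ) : ℕ → ℂ → ℂ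
  | 0 => phi q
  | k + 1 => fun z => z * deriv (phiEuler q k) z

theorem analyticAt_phiEuler (h1 : ‖q‖ < 1) (k : ℕ) {z : ℂ} (hz : z ≠ 0) :
    AnalyticAt ℂ (phiEuler q k) z := by
  induction k generalizing z with
  | zero => exact analyticAt_phi h1 hz
  | succ k ih => exact analyticAt_id.mul (ih hz).deriv

theorem iteratedDeriv_phi_mul_exp (h1 : ‖q‖ < 1) (k : ℕ) {U : ℂ} (hU : U ≠ 0) :
    iteratedDeriv k (fun s => phi q (U * exp s)) = fun s => phiEuler q k (U * exp s) := by
  induction k with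
  | zero => simp [phiEuler]
  | succ k ih =>
    rw [iteratedDeriv_succ, ih]
    funext s
    have hd := (analyticAt_phiEuler h1 k (mul_ne_zero hU (exp_ne_zero s))).differentiableAt
    have h2 : HasDerivAt (fun s => U * exp s) (U * exp s) s := (hasDerivAt_exp s).const_mul U
    have := HasDerivAt.comp s hd.hasDerivAt h2
    rw [show (fun s => phiEuler q k (U * exp s)) = phiEuler q k ∘ fun s => U * exp s from rfl,
      this.deriv, phiEuler, mul_comm]

/-- The numerator of `kronDeriv` with respect to the denominator `phi`. -/
noncomputable def kronNum (q t : ℂ) (k : ℕ) (U : ℂ) : ℂ :=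
  ∑ j ∈ Finset.range (k + 1), (k.choose j : ℂ) * phiEuler q j (U * exp t) *
    iteratedDeriv (k - j) (fun s => (phi q (exp s))⁻¹) t

theorem analyticAt_kronNum (h1 : ‖q‖ < 1) (t : ℂ) (k : ℕ) {U : ℂ} (hU : U ≠ 0) :
    AnalyticAt ℂ (kronNum q t k) U := by
  refine Finset.analyticAt_fun_sum _ fun j _ => (analyticAt_const.mul ?_).mul analyticAt_const
  refine AnalyticAt.comp (g := phiEuler q j) (f := fun z => z * exp t)
    (analyticAt_phiEuler h1 j (mul_ne_zero hU (exp_ne_zero t))) ?_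
  exact analyticAt_id.mul analyticAt_const

/-- The denominator `phi q U` does not involve t, so differentiation in t does not raise the order
of the poles in U. -/
theorem kronDeriv_eq (h1 : ‖q‖ < 1) {t : ℂ} (ht : phi q (exp t) ≠ 0) (k : ℕ) {U : ℂ}
    (hU : U ≠ 0) : kronDeriv q t k U = kronNum q t k U / phi q U := by
  have e : (fun s => kron q U s) =
      fun s => (phi q U)⁻¹ * (phi q (U * exp s) * (phi q (exp s))⁻¹) := by
    funext s
    rw [kron, div_mul_eq_div_div_swap, div_eq_mul_inv, mul_comm, div_eq_mul_inv]
  have hinv : AnalyticAt ℂ (fun s => (phi q (exp s))⁻¹) t := by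
    refine AnalyticAt.fun_inv ?_ ht
    simpa using analyticAt_phi_mul_exp h1 one_ne_zero t
  rw [kronDeriv, e, iteratedDeriv_const_mul_field,
    iteratedDeriv_fun_mul (analyticAt_phi_mul_exp h1 hU t).contDiffAt hinv.contDiffAt, kronNum,
    div_eq_inv_mul]
  simp only [iteratedDeriv_phi_mul_exp h1 _ hU]

end

/-! ### The meromorphic continuation and its uniqueness. -/

section

open Complex Filter Topology

variable {q : ℂ} {n : ℕ}

/-- The product of the values of `phi` at the products of `u` over the nonempty sets of indices. -/
noncomputable def phiProd (q : ℂ) (u : Fin n → ℂ) : ℂ :=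
  ∏ B ∈ (Finset.univ : Finset (Finset (Fin n))).erase ∅, phi q (∏ i ∈ B, u i)

theorem phiProd_ne_zero_iff {u : Fin n → ℂ} :
    phiProd q u ≠ 0 ↔ ∀ B : Finset (Fin n), B.Nonempty → phi q (∏ i ∈ B, u i) ≠ 0 := by
  simp [phiProd, Finset.prod_ne_zero_iff, Finset.nonempty_iff_ne_empty]

theorem analyticAt_prod_coord (B : Finset (Fin n)) (u : Fin n → ℂ) :
    AnalyticAt ℂ (fun w : Fin n → ℂ => ∏ i ∈ B, w i) u :=
  Finset.analyticAt_fun_prod _ fun i _ => (ContinuousLinearMap.proj (R := ℂ) i).analyticAt u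

theorem prod_ne_zero_of_mem_cTorus {u : Fin n → ℂ} (hu : u ∈ cTorus n) (B : Finset (Fin n)) :
    ∏ i ∈ B, u i ≠ 0 :=
  Finset.prod_ne_zero_iff.2 fun i _ => hu i

theorem analyticAt_phi_prod (h1 : ‖q‖ < 1) {u : Fin n → ℂ} (hu : u ∈ cTorus n)
    (B : Finset (Fin n)) : AnalyticAt ℂ (fun w : Fin n → ℂ => phi q (∏ i ∈ B, w i)) u :=
  AnalyticAt.comp (g := phi q) (f := fun w : Fin n → ℂ => ∏ i ∈ B, w i)
    (analyticAt_phi h1 (prod_ne_zero_of_mem_cTorus hu B)) (analyticAt_prod_coord B u)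

theorem analyticAt_phiProd (h1 : ‖q‖ < 1) {u : Fin n → ℂ} (hu : u ∈ cTorus n) :
    AnalyticAt ℂ (fun w : Fin n → ℂ => phiProd q w) u :=
  Finset.analyticAt_fun_prod _ fun B _ => analyticAt_phi_prod h1 hu B

/-- Each block B contributes one denominator `phi q (∏ i ∈ B, u i)`, a factor of `phiProd`, and a
partition of s has at most |s| blocks. -/
theorem exists_moment_num (h1 : ‖q‖ < 1) {t : ℂ} (ht : phi q (exp t) ≠ 0) (s : Finset (Fin n)) :
    ∃ A : (Fin n → ℂ) → ℂ, AnalyticOnNhd ℂ A (cTorus n) ∧ ∀ u ∈ cTorus n, phiProd q u ≠ 0 →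
      phiProd q u ^ s.card * moment (kronDeriv q t) u s = A u := by
  induction s using finset_induction_min with
  | h0 =>
    exact ⟨fun _ => 1, fun _ _ => analyticAt_const, fun u _ _ => by simp [moment_empty]⟩
  | hs a s ha ih =>
    choose A hA hA' using ih
    have has : a ∉ s := fun h => lt_irrefl _ (ha a h)
    refine ⟨fun u => ∑ J ∈ s.powerset, kronNum q t J.card (∏ i ∈ insert a J, u i) *
      (∏ B ∈ ((Finset.univ : Finset (Finset (Fin n))).erase ∅).erase (insert a J),
        phi q (∏ i ∈ B, u i)) * phiProd q u ^ (s.card - (s \ J).card) *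
      A (s \ J) Finset.sdiff_subset u, fun u hu => ?_, fun u hu hne => ?_⟩
    · refine Finset.analyticAt_fun_sum _ fun J _ => ((AnalyticAt.mul ?_ ?_).mul
        ((analyticAt_phiProd h1 hu).fun_pow _)).mul (hA _ _ u hu)
      · exact AnalyticAt.comp (g := kronNum q t J.card)
          (f := fun w : Fin n → ℂ => ∏ i ∈ insert a J, w i)
          (analyticAt_kronNum h1 t _ (prod_ne_zero_of_mem_cTorus hu _)) (analyticAt_prod_coord _ u)
      · exact Finset.analyticAt_fun_prod _ fun B _ => analyticAt_phi_prod h1 hu B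
    · rw [moment_insert _ _ ha, Finset.mul_sum]
      refine Finset.sum_congr rfl fun J hJ => ?_
      have hJ' := Finset.mem_powerset.1 hJ
      have haJ : a ∉ J := fun h => has (hJ' h)
      have hmem : insert a J ∈ (Finset.univ : Finset (Finset (Fin n))).erase ∅ := by simp
      have hphi : phi q (∏ i ∈ insert a J, u i) ≠ 0 :=
        phiProd_ne_zero_iff.1 hne _ (Finset.insert_nonempty _ _)
      have hsplit := Finset.mul_prod_erase _ (fun B : Finset (Fin n) => phi q (∏ i ∈ B, u i)) hmem
      rw [← Finset.prod_insert haJ, kronDeriv_eq h1 ht _ (prod_ne_zero_of_mem_cTorus hu _),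
        ← hA' _ _ u hu hne, Finset.card_insert_of_notMem has]
      have hcard : s.card + 1 = (s.card - (s \ J).card) + 1 + (s \ J).card := by
        have := Finset.card_le_card (Finset.sdiff_subset : s \ J ⊆ s)
        omega
      rw [hcard, pow_add, pow_succ]
      have e : phiProd q u * (kronNum q t J.card (∏ i ∈ insert a J, u i) /
          phi q (∏ i ∈ insert a J, u i)) = kronNum q t J.card (∏ i ∈ insert a J, u i) *
          ∏ B ∈ ((Finset.univ : Finset (Finset (Fin n))).erase ∅).erase (insert a J),
            phi q (∏ i ∈ B, u i) := by
        rw [phiProd, ← hsplit]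
        field_simp
      rw [← e]
      ring

/-- Both sides are sums of the same Laurent series in u. -/
theorem moment_univ_eq (hn : 1 ≤ n) {u : Fin n → ℂ} {r : Fin n → ℝ} (h : OmegaGW q u r)
    (h0 : q ≠ 0) (h1 : ‖q‖ < 1) {t : ℂ} (ht : t ∈ fundStrip q) :
    moment (kronDeriv q t) u Finset.univ = kron q (∏ i, u i) t * cycleIntegral q u r := by
  rw [kron_mul_cycleIntegral hn h h0 h1 ht]
  refine (hasSum_moment (p := fun j m => iteratedDeriv j (kronCoeff q m) t)
    (iteratedDeriv_kronCoeff h0 h1 ht) (fun B hB k => hasSum_kronDeriv h0 h1 ht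
      (h.prod_bounds hB).1 (h.prod_bounds hB).2 k) Finset.univ).unique ?_
  convert! hasSum_torusMean_det h h0 h1 ht using 2 with m
  simp [momentTerm]

theorem OmegaGW.mem_cTorus {u : Fin n → ℂ} {r : Fin n → ℝ} (h : OmegaGW q u r) : u ∈ cTorus n :=
  fun i => norm_pos_iff.1 (zero_lt_one.trans (h.one_lt_norm i))

theorem OmegaGW.phiProd_ne_zero {u : Fin n → ℂ} {r : Fin n → ℝ} (h : OmegaGW q u r)
    (h1 : ‖q‖ < 1) : phiProd q u ≠ 0 :=
  phiProd_ne_zero_iff.2 fun _ hB =>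
    phi_ne_zero_of_one_lt h1 (h.prod_bounds hB).1 (h.prod_bounds hB).2

/-- The denominator of the continuation attached to `t`. -/
noncomputable def contDen (q t : ℂ) (u : Fin n → ℂ) : ℂ :=
  phi q ((∏ i, u i) * exp t) * phiProd q u ^ n

theorem analyticOnNhd_contDen (h1 : ‖q‖ < 1) (t : ℂ) :
    AnalyticOnNhd ℂ (contDen (n := n) q t) (cTorus n) := by
  intro u hu
  refine AnalyticAt.mul ?_ ((analyticAt_phiProd h1 hu).fun_pow n)
  exact AnalyticAt.comp (g := phi q) (f := fun w : Fin n → ℂ => (∏ i, w i) * exp t)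
    (analyticAt_phi h1 (mul_ne_zero (prod_ne_zero_of_mem_cTorus hu _) (exp_ne_zero t)))
    ((analyticAt_prod_coord _ u).mul analyticAt_const)

theorem exists_isContinuation (hn : 1 ≤ n) (h0 : q ≠ 0) (h1 : ‖q‖ < 1) {t : ℂ}
    (ht : t ∈ fundStrip q) (hne : ∃ u ∈ cTorus n, contDen q t u ≠ 0) :
    ∃ N : (Fin n → ℂ) → ℂ, IsContinuation q n N (contDen q t) ∧
      ∀ u ∈ cTorus n, phiProd q u ≠ 0 → N u = phi q (∏ i, u i) * phi q (exp t) *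
        (phiProd q u ^ n * moment (kronDeriv q t) u Finset.univ) := by
  have hpt := phi_exp_ne_zero h1 ht
  obtain ⟨A, hA, hA'⟩ := exists_moment_num (n := n) h1 hpt Finset.univ
  rw [Finset.card_univ, Fintype.card_fin] at hA'
  refine ⟨fun u => phi q (∏ i, u i) * phi q (exp t) * A u,
    ⟨fun u hu => ((analyticAt_phi_prod h1 hu _).mul analyticAt_const).mul (hA u hu),
      analyticOnNhd_contDen h1 t, hne, fun u r h => ?_⟩, fun u hu hP => by rw [hA' u hu hP]⟩
  have hP := h.phiProd_ne_zero h1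
  have hphi : phi q (∏ i, u i) ≠ 0 := phiProd_ne_zero_iff.1 hP _ ⟨first hn, Finset.mem_univ _⟩
  rw [← hA' u h.mem_cTorus hP, moment_univ_eq hn h h0 h1 ht, contDen, kron]
  field_simp

theorem isOpen_omegaGW (q : ℂ) (r : Fin n → ℝ) : IsOpen {u : Fin n → ℂ | OmegaGW q u r} := by
  rw [isOpen_iff_eventually]
  intro u hu
  have hc : ∀ i, ContinuousAt (fun w : Fin n → ℂ => ‖w i‖ * r i) u := fun i =>
    ((continuous_apply i).norm.mul continuous_const).continuousAt
  have hc' : ∀ i, ContinuousAt (fun w : Fin n → ℂ => ‖q‖ * (‖w i‖ * r i)) u :=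
    fun i => (continuous_const.mul ((continuous_apply i).norm.mul continuous_const)).continuousAt
  have e1 : ∀ᶠ w in 𝓝 u, ∀ i, r i < ‖w i‖ * r i :=
    eventually_all.2 fun i => (hc i).eventually_const_lt (hu.2.1 i)
  have e2 : ∀ᶠ w in 𝓝 u, ∀ i j, i < j → ‖w j‖ * r j < r i :=
    eventually_all.2 fun i => eventually_all.2 fun j => by
      by_cases hij : i < j
      · filter_upwards [(hc j).eventually_lt_const (hu.2.2.1 i j hij)] with w hw _ using hw
      · exact Eventually.of_forall fun w h => absurd h hij
  have e3 : ∀ᶠ w in 𝓝 u, ∀ i j, ‖q‖ * (‖w i‖ * r i) < r j :=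
    eventually_all.2 fun i => eventually_all.2 fun j =>
      (hc' i).eventually_lt_const (hu.2.2.2 i j)
  filter_upwards [e1, e2, e3] with w w1 w2 w3
  exact ⟨hu.1, w1, w2, w3⟩

theorem exists_omegaGW (n : ℕ) (h1 : ‖q‖ < 1) :
    ∃ (u : Fin n → ℂ) (r : Fin n → ℝ), OmegaGW q u r := by
  have hc : ContinuousAt (fun x : ℝ => x ^ (2 * n)) 1 := by fun_prop
  have h2 : ∀ᶠ x : ℝ in 𝓝[<] 1, ‖q‖ < x ^ (2 * n) ∧ 0 < x :=
    nhdsWithin_le_nhds ((hc.eventually_const_lt (by simpa using h1)).and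
      (lt_mem_nhds zero_lt_one))
  obtain ⟨x, ⟨hx, hx0⟩, hx1⟩ := (h2.and self_mem_nhdsWithin).exists
  have hx1 : x < 1 := hx1
  have hn : ‖(x : ℂ)⁻¹‖ = x⁻¹ := by simp [abs_of_pos hx0]
  -- The absolute values in the chain become x^{-1} > 1 > x > x² > ⋯ > x^{2n-2}; x is so close to 1
  -- that all of them fit in one annulus.
  refine ⟨fun _ => (x : ℂ)⁻¹, fun i => x ^ (2 * (i : ℕ)), fun i => by positivity, fun i => ?_,
    fun i j hij => ?_, fun i j => ?_⟩
  · rw [hn]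
    exact lt_mul_of_one_lt_left (by positivity) ((one_lt_inv₀ hx0).2 hx1)
  · have hij' : (i : ℕ) + 1 ≤ j := hij
    simp only [hn]
    rw [inv_mul_lt_iff₀ hx0, ← pow_succ']
    have : 2 * (i : ℕ) + 1 < 2 * (j : ℕ) := by omega
    exact pow_lt_pow_right_of_lt_one₀ hx0 hx1 this
  · simp only [hn]
    have hj : 2 * (j : ℕ) + 1 ≤ 2 * n := by omega
    calc ‖q‖ * (x⁻¹ * x ^ (2 * (i : ℕ))) ≤ ‖q‖ * (x⁻¹ * 1) := by
          gcongr
          exact pow_le_one₀ hx0.le hx1.le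
      _ < x ^ (2 * n) * (x⁻¹ * 1) := by gcongr
      _ ≤ x ^ (2 * (j : ℕ) + 1) * (x⁻¹ * 1) := by
          exact mul_le_mul_of_nonneg_right (pow_le_pow_of_le_one hx0.le hx1.le hj) (by positivity)
      _ = x ^ (2 * (j : ℕ)) := by rw [pow_succ]; field_simp

theorem isPreconnected_cTorus (n : ℕ) : IsPreconnected (cTorus n) := by
  have : cTorus n = Set.univ.pi fun _ => ({0}ᶜ : Set ℂ) := by
    ext u; simp [cTorus]
  rw [this]
  exact isPreconnected_univ_pi fun _ => (isConnected_compl_singleton_of_one_lt_rank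
    (by simp) 0).isPreconnected

theorem isOpen_cTorus (n : ℕ) : IsOpen (cTorus n) := by
  have : cTorus n = ⋂ i, {u : Fin n → ℂ | u i ≠ 0} := by
    ext u; simp [cTorus]
  rw [this]
  exact isOpen_iInter_of_finite fun i => isOpen_ne_fun (continuous_apply i) continuous_const

/-- The identity theorem on the connected torus, started from the nonempty open set of u admissible
for one fixed r. -/
theorem IsContinuation.mul_eq_mul (h1 : ‖q‖ < 1) {N D N' D' : (Fin n → ℂ) → ℂ}
    (h : IsContinuation q n N D) (h' : IsContinuation q n N' D') {u : Fin n → ℂ}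
    (hu : u ∈ cTorus n) : N u * D' u = N' u * D u := by
  obtain ⟨w, r, hw⟩ := exists_omegaGW n h1
  refine (h.num.mul h'.den).eqOn_of_preconnected_of_eventuallyEq (h'.num.mul h.den)
    (isPreconnected_cTorus n) hw.mem_cTorus ?_ hu
  filter_upwards [(isOpen_omegaGW q r).mem_nhds hw] with x hx
  change N x * D' x = N' x * D x
  rw [h.continues x r hx, h'.continues x r hx]
  ring

theorem IsContinuation.TGW_eq (h1 : ‖q‖ < 1) {N D : (Fin n → ℂ) → ℂ}
    (h : IsContinuation q n N D) {u : Fin n → ℂ} (hu : u ∈ cTorus n) (hD : D u ≠ 0) :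
    TGW q n u = N u / D u := by
  have hex : ∃ p : ((Fin n → ℂ) → ℂ) × ((Fin n → ℂ) → ℂ),
      u ∈ cTorus n ∧ IsContinuation q n p.1 p.2 ∧ p.2 u ≠ 0 := ⟨(N, D), hu, h, hD⟩
  rw [TGW, dif_pos hex, div_eq_div_iff hex.choose_spec.2.2 hD]
  exact hex.choose_spec.2.1.mul_eq_mul h1 h hu

theorem RegularAt.continuousAt (h1 : ‖q‖ < 1) {u : Fin n → ℂ} (h : RegularAt q n u) :
    ContinuousAt (TGW q n) u := by
  obtain ⟨hu, N, D, hND, hD⟩ := h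
  have hev : TGW q n =ᶠ[𝓝 u] fun w => N w / D w := by
    filter_upwards [(isOpen_cTorus n).mem_nhds hu, (hND.den u hu).continuousAt.eventually_ne hD]
      with w hw hDw
    exact hND.TGW_eq h1 hw hDw
  exact ((hND.num u hu).continuousAt.div (hND.den u hu).continuousAt hD).congr hev.symm

theorem exists_contDen_ne_zero (hn : 1 ≤ n) (h1 : ‖q‖ < 1) :
    ∃ t ∈ fundStrip q, ∃ u ∈ cTorus n, contDen q t u ≠ 0 := by
  obtain ⟨u, r, h⟩ := exists_omegaGW n h1
  have hb := h.prod_bounds (B := Finset.univ) ⟨first hn, Finset.mem_univ _⟩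
  set U := ∏ i, u i
  have hU : 0 < ‖U‖ := zero_lt_one.trans hb.1
  -- With e^t = x > 1/|U|, the point U e^t stays in the annulus between 1 and 1/|q|, where `phi` has
  -- no zeros.
  obtain ⟨x, hx, hx1⟩ := exists_between (max_lt h1 (inv_lt_one_of_one_lt₀ hb.1))
  have hxq := (le_max_left _ _).trans_lt hx
  have hx0 : 0 < x := (norm_nonneg q).trans_lt hxq
  have hxU := (le_max_right _ _).trans_lt hx
  have he : exp (Real.log x : ℂ) = x := by
    rw [← Complex.ofReal_exp, Real.exp_log hx0]
  have hne : ‖exp (Real.log x : ℂ)‖ = x := by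
    rw [he, Complex.norm_real, Real.norm_of_nonneg hx0.le]
  refine ⟨(Real.log x : ℂ), ⟨by rwa [hne], by rwa [hne]⟩, u, h.mem_cTorus,
    mul_ne_zero ?_ (pow_ne_zero _ (h.phiProd_ne_zero h1))⟩
  refine phi_ne_zero_of_one_lt h1 ?_ ?_
  · rw [norm_mul, hne]
    rwa [inv_lt_iff_one_lt_mul₀' hU] at hxU
  · rw [norm_mul, hne]
    calc ‖q‖ * (‖U‖ * x) ≤ ‖q‖ * (‖U‖ * 1) := by gcongr
      _ < 1 := by rw [mul_one]; exact hb.2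

end

/-! ### The q-difference equation. -/

section

open Complex Filter Topology

variable {q : ℂ} {n : ℕ}

theorem contDen_ne_zero_iff (hn : 1 ≤ n) {t : ℂ} {u : Fin n → ℂ} :
    contDen q t u ≠ 0 ↔ phi q ((∏ i, u i) * exp t) ≠ 0 ∧ phiProd q u ≠ 0 := by
  rw [contDen, mul_ne_zero_iff, pow_ne_zero_iff (by omega)]

theorem TGW_eq_moment (hn : 1 ≤ n) (h0 : q ≠ 0) (h1 : ‖q‖ < 1) {t : ℂ} (ht : t ∈ fundStrip q)
    {u : Fin n → ℂ} (hu : u ∈ cTorus n) (hD : contDen q t u ≠ 0) :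
    RegularAt q n u ∧ TGW q n u = phi q (∏ i, u i) * phi q (exp t) / phi q ((∏ i, u i) * exp t) *
      moment (kronDeriv q t) u Finset.univ := by
  obtain ⟨N, hN, hN'⟩ := exists_isContinuation hn h0 h1 ht ⟨u, hu, hD⟩
  obtain ⟨h2, h3⟩ := (contDen_ne_zero_iff hn).1 hD
  refine ⟨⟨hu, N, _, hN, hD⟩, ?_⟩
  rw [hN.TGW_eq h1 hu hD, hN' u hu h3, contDen]
  field_simp

theorem prod_update_mul (u : Fin n → ℂ) (a : Fin n) (c : ℂ) (B : Finset (Fin n)) :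
    ∏ i ∈ B, Function.update u a (c * u a) i = (if a ∈ B then c else 1) * ∏ i ∈ B, u i := by
  split_ifs with h
  · rw [← Finset.mul_prod_erase _ _ h, ← Finset.mul_prod_erase B u h, Function.update_self,
      mul_assoc]
    congr 2
    exact Finset.prod_congr rfl fun i hi => Function.update_of_ne (Finset.ne_of_mem_erase hi) _ _
  · rw [one_mul]
    exact Finset.prod_congr rfl fun i hi => Function.update_of_ne (ne_of_mem_of_not_mem hi h) _ _

theorem prod_update_eq_prod_union (u : Fin n → ℂ) {a : Fin n} {B I : Finset (Fin n)}
    (hB : Disjoint B I) :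
    ∏ i ∈ B, Function.update u a (u a * ∏ i ∈ I, u i) i =
      ∏ i ∈ if a ∈ B then B ∪ I else B, u i := by
  rw [mul_comm (u a), prod_update_mul]
  split_ifs with h
  · rw [Finset.prod_union hB, mul_comm]
  · rw [one_mul]

theorem phi_mul_q_ne_zero (h0 : q ≠ 0) (h1 : ‖q‖ < 1) {x : ℂ} (hx : x ≠ 0) (h : phi q x ≠ 0) :
    phi q (q * x) ≠ 0 := by
  rw [phi_mul_q h0 h1 x hx]
  exact div_ne_zero (neg_ne_zero.2 h) hx

theorem update_mem_cTorus {u : Fin n → ℂ} (hu : u ∈ cTorus n) (a : Fin n) {c : ℂ} (hc : c ≠ 0) :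
    Function.update u a c ∈ cTorus n := by
  intro i
  rcases eq_or_ne i a with rfl | hi
  · rwa [Function.update_self]
  · rw [Function.update_of_ne hi]
    exact hu i

theorem contDen_update_mul_q (hn : 1 ≤ n) (h0 : q ≠ 0) (h1 : ‖q‖ < 1) {t : ℂ} {u : Fin n → ℂ}
    (hu : u ∈ cTorus n) (hD : contDen q t u ≠ 0) (a : Fin n) :
    contDen q t (Function.update u a (q * u a)) ≠ 0 := by
  rw [contDen_ne_zero_iff hn] at hD ⊢
  refine ⟨?_, phiProd_ne_zero_iff.2 fun B hB => ?_⟩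
  · rw [prod_update_mul, if_pos (Finset.mem_univ a), mul_assoc]
    exact phi_mul_q_ne_zero h0 h1
      (mul_ne_zero (prod_ne_zero_of_mem_cTorus hu _) (exp_ne_zero t)) hD.1
  · rw [prod_update_mul]
    split_ifs
    · exact phi_mul_q_ne_zero h0 h1 (prod_ne_zero_of_mem_cTorus hu _)
        (phiProd_ne_zero_iff.1 hD.2 B hB)
    · rw [one_mul]
      exact phiProd_ne_zero_iff.1 hD.2 B hB

/-- Products of merged variables are products of the original ones, so nonvanishing of `phiProd` at
u passes to all merged tuples. -/
theorem prod_merge (hn : 1 ≤ n) (u : Fin n → ℂ) (I : Finset (Fin n))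
    (B : Finset (Fin (n - I.card))) :
    ∃ C : Finset (Fin n), (B.Nonempty → C.Nonempty) ∧ ∏ k ∈ B, merge hn u I k = ∏ i ∈ C, u i := by
  set f := (Iᶜ).orderEmbOfFin (card_compl_fin I) with hf
  have hdis : Disjoint (B.map f.toEmbedding) I := by
    rw [Finset.disjoint_left]
    intro i hi
    obtain ⟨k, _, rfl⟩ := Finset.mem_map.1 hi
    exact Finset.mem_compl.1 (Finset.orderEmbOfFin_mem _ _ k)
  refine ⟨if first hn ∈ B.map f.toEmbedding then B.map f.toEmbedding ∪ I else B.map f.toEmbedding,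
    fun hB => ?_, ?_⟩
  · have := hB.map (f := f.toEmbedding)
    split_ifs
    · exact this.mono Finset.subset_union_left
    · exact this
  · rw [← prod_update_eq_prod_union u hdis, Finset.prod_map]
    rfl

theorem map_orderEmbOfFin_compl (I : Finset (Fin n)) :
    (Finset.univ : Finset (Fin (n - I.card))).map
      ((Iᶜ).orderEmbOfFin (card_compl_fin I)).toEmbedding = Iᶜ :=
  Finset.map_orderEmbOfFin_univ _ _

theorem prod_univ_merge (hn : 1 ≤ n) (u : Fin n → ℂ) {I : Finset (Fin n)} (hI : first hn ∉ I) :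
    ∏ k, merge hn u I k = ∏ i, u i := by
  have e : ∏ k, merge hn u I k = ∏ i ∈ (Finset.univ : Finset (Fin (n - I.card))).map
      ((Iᶜ).orderEmbOfFin (card_compl_fin I)).toEmbedding,
      Function.update u (first hn) (u (first hn) * ∏ i ∈ I, u i) i := by
    rw [Finset.prod_map]
    rfl
  rw [e, map_orderEmbOfFin_compl,
    prod_update_eq_prod_union u (disjoint_compl_left), if_pos (Finset.mem_compl.2 hI),
    Finset.union_comm, Finset.union_compl]

theorem merge_mem_cTorus (hn : 1 ≤ n) {u : Fin n → ℂ} (hu : u ∈ cTorus n) (I : Finset (Fin n)) :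
    merge hn u I ∈ cTorus (n - I.card) := fun _ =>
  update_mem_cTorus hu _ (mul_ne_zero (hu _) (prod_ne_zero_of_mem_cTorus hu I)) _

theorem one_le_sub_card (hn : 1 ≤ n) {I : Finset (Fin n)} (hI : first hn ∉ I) :
    1 ≤ n - I.card := by
  rw [← card_compl_fin, Nat.one_le_iff_ne_zero, Ne, Finset.card_eq_zero]
  exact Finset.ne_empty_of_mem (Finset.mem_compl.2 hI)

theorem contDen_merge (hn : 1 ≤ n) {t : ℂ} {u : Fin n → ℂ} (hD : contDen q t u ≠ 0)
    {I : Finset (Fin n)} (hI : first hn ∉ I) : contDen q t (merge hn u I) ≠ 0 := by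
  rw [contDen_ne_zero_iff hn] at hD
  refine (contDen_ne_zero_iff (one_le_sub_card hn hI)).2
    ⟨by rw [prod_univ_merge hn u hI]; exact hD.1, phiProd_ne_zero_iff.2 fun B hB => ?_⟩
  obtain ⟨C, hC, e⟩ := prod_merge hn u I B
  rw [e]
  exact phiProd_ne_zero_iff.1 hD.2 C (hC hB)

theorem moment_merge (κ : ℕ → ℂ → ℂ) (hn : 1 ≤ n) (u : Fin n → ℂ) (I : Finset (Fin n)) :
    moment κ (merge hn u I) Finset.univ =
      moment κ (Function.update u (first hn) (u (first hn) * ∏ i ∈ I, u i)) Iᶜ := by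
  rw [← map_orderEmbOfFin_compl I, ← moment_map]
  rfl

/-- Merging preserves U = ∏u_i, so every term on the right has the same prefactor 1/κ(U, t). Under U
↦ qU this prefactor gains e^t, which cancels the e^{-t} of `moment_update`; the subset I = ∅ gives
the term T_n(u). -/
theorem TGW_update_of_contDen_ne_zero (hn : 1 ≤ n) (h0 : q ≠ 0) (h1 : ‖q‖ < 1) {t : ℂ}
    (ht : t ∈ fundStrip q) {u : Fin n → ℂ} (hu : u ∈ cTorus n) (hD : contDen q t u ≠ 0) :
    TGW q n (Function.update u (first hn) (q * u (first hn))) = TGW q n u +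
      ∑ I ∈ subsetsAvoidingFirst hn, (-1) ^ I.card * TGW q (n - I.card) (merge hn u I) := by
  set a := first hn with ha
  have hpt := phi_exp_ne_zero h1 ht
  have hU := prod_ne_zero_of_mem_cTorus hu Finset.univ
  have hmin : ∀ i ∈ Finset.univ.erase a, a < i := fun i hi =>
    lt_of_le_of_ne (Fin.mk_le_of_le_val (Nat.zero_le _)) (Finset.ne_of_mem_erase hi).symm
  have hins : ∀ I, a ∉ I → insert a (Finset.univ.erase a \ I) = Iᶜ := by
    intro I hI
    ext i
    by_cases h : i = a
    · simp [h, hI]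
    · simp [h]
  have key := moment_update (κ := kronDeriv q t) (u := u) (b := exp (-t)) (q := q) hmin
    fun J hJ k => kronDeriv_mul_q h0 h1
      (mul_ne_zero (hu a) (prod_ne_zero_of_mem_cTorus hu J)) hpt k
  rw [Finset.insert_erase (Finset.mem_univ a)] at key
  have hset : (Finset.univ.erase a).powerset = insert ∅ (subsetsAvoidingFirst hn) := by
    ext I
    by_cases h : I = ∅
    · simp [h]
    · simp [subsetsAvoidingFirst, h, Finset.subset_erase, Finset.nonempty_iff_ne_empty, ← ha]
  have hem : (∅ : Finset (Fin n)) ∉ subsetsAvoidingFirst hn := by simp [subsetsAvoidingFirst]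
  rw [hset, Finset.sum_insert hem, hins ∅ (Finset.notMem_empty a)] at key
  simp only [Finset.card_empty, pow_zero, one_mul, Finset.prod_empty, mul_one,
    Function.update_eq_self, Finset.compl_empty] at key
  have hsum : ∑ I ∈ subsetsAvoidingFirst hn, (-1) ^ I.card * TGW q (n - I.card) (merge hn u I) =
      phi q (∏ i, u i) * phi q (exp t) / phi q ((∏ i, u i) * exp t) *
      ∑ I ∈ subsetsAvoidingFirst hn, (-1) ^ I.card * moment (kronDeriv q t)
        (Function.update u a (u a * ∏ i ∈ I, u i)) (insert a (Finset.univ.erase a \ I)) := by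
    rw [Finset.mul_sum]
    refine Finset.sum_congr rfl fun I hI => ?_
    have hI' : a ∉ I := (Finset.mem_filter.1 hI).2.2
    rw [(TGW_eq_moment (one_le_sub_card hn hI') h0 h1 ht (merge_mem_cTorus hn hu I)
      (contDen_merge hn hD hI')).2, prod_univ_merge hn u hI', moment_merge, hins I hI']
    ring
  rw [hsum, (TGW_eq_moment hn h0 h1 ht hu hD).2, ← mul_add,
    (TGW_eq_moment hn h0 h1 ht (update_mem_cTorus hu a (mul_ne_zero h0 (hu a)))
      (contDen_update_mul_q hn h0 h1 hu hD a)).2, key, prod_update_mul,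
    if_pos (Finset.mem_univ a), mul_assoc q, phi_mul_q h0 h1 _ hU,
    phi_mul_q h0 h1 _ (mul_ne_zero hU (exp_ne_zero t)), exp_neg]
  have h2 := ((contDen_ne_zero_iff hn).1 hD).1
  have h3 := exp_ne_zero t
  field_simp

theorem continuous_update_mul (a : Fin n) (c : ℂ) :
    Continuous fun u : Fin n → ℂ => Function.update u a (c * u a) :=
  continuous_id.update a (continuous_const.mul (continuous_apply a))

theorem continuous_merge (hn : 1 ≤ n) (I : Finset (Fin n)) :
    Continuous fun u : Fin n → ℂ => merge hn u I :=
  continuous_pi fun _ => (continuous_apply _).comp (continuous_id.update _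
    ((continuous_apply _).mul (continuous_finsetProd _ fun i _ => continuous_apply i)))

theorem frequently_ne_zero {D : (Fin n → ℂ) → ℂ} (hD : AnalyticOnNhd ℂ D (cTorus n))
    (hne : ∃ u ∈ cTorus n, D u ≠ 0) {u : Fin n → ℂ} (hu : u ∈ cTorus n) :
    ∃ᶠ w in 𝓝 u, D w ≠ 0 := by
  intro h
  obtain ⟨w, hw, hDw⟩ := hne
  exact hDw (hD.eqOn_zero_of_preconnected_of_eventuallyEq_zero (isPreconnected_cTorus n) hu
    (h.mono fun x hx => not_not.1 hx) hw)

/-- A regular point may be a zero of `contDen`, but points where `contDen` is nonzero accumulate at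
it, and both sides are continuous there. -/
theorem TGW_update_mul_q (hn : 1 ≤ n) (h0 : q ≠ 0) (h1 : ‖q‖ < 1) {u : Fin n → ℂ}
    (hu : RegularAt q n u)
    (hu' : RegularAt q n (Function.update u (first hn) (q * u (first hn))))
    (hI : ∀ I ∈ subsetsAvoidingFirst hn, RegularAt q (n - I.card) (merge hn u I)) :
    TGW q n (Function.update u (first hn) (q * u (first hn))) = TGW q n u +
      ∑ I ∈ subsetsAvoidingFirst hn, (-1) ^ I.card * TGW q (n - I.card) (merge hn u I) := by
  obtain ⟨t, ht, hne⟩ := exists_contDen_ne_zero (n := n) hn h1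
  have hfreq := (frequently_ne_zero (analyticOnNhd_contDen h1 t) hne hu.1).and_eventually
    ((isOpen_cTorus n).mem_nhds hu.1)
  have hL : ContinuousAt
      (fun w => TGW q n (Function.update w (first hn) (q * w (first hn)))) u :=
    ContinuousAt.comp (g := TGW q n) (hu'.continuousAt h1)
      (continuous_update_mul (first hn) q).continuousAt
  have hR : ContinuousAt (fun w => TGW q n w +
      ∑ I ∈ subsetsAvoidingFirst hn, (-1) ^ I.card * TGW q (n - I.card) (merge hn w I)) u := by
    refine (hu.continuousAt h1).add (tendsto_finsetSum _ fun I h => ?_)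
    exact continuousAt_const.mul (ContinuousAt.comp (g := TGW q (n - I.card))
      ((hI I h).continuousAt h1) (continuous_merge hn I).continuousAt)
  have hcl : ∃ᶠ w in 𝓝 u, TGW q n (Function.update w (first hn) (q * w (first hn))) -
      (TGW q n w + ∑ I ∈ subsetsAvoidingFirst hn,
        (-1) ^ I.card * TGW q (n - I.card) (merge hn w I)) = 0 :=
    hfreq.mono fun w hw => sub_eq_zero.2 (TGW_update_of_contDen_ne_zero hn h0 h1 ht hw.2 hw.1)
  by_contra hcon
  exact hcl ((hL.sub hR).eventually_ne (sub_ne_zero.2 hcon))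

end

end EllipticGW

theorem mainTheorem5 (q : ℂ) (hq0 : 0 < ‖q‖) (hq1 : ‖q‖ < 1) (n : ℕ) (hn : 1 ≤ n) :
    (∃ N D, EllipticGW.IsContinuation q n N D) ∧
    ∀ u : Fin n → ℂ,
      EllipticGW.RegularAt q n u →
      EllipticGW.RegularAt q n
        (Function.update u (EllipticGW.first hn) (q * u (EllipticGW.first hn))) →
      (∀ I ∈ EllipticGW.subsetsAvoidingFirst hn,
        EllipticGW.RegularAt q (n - I.card) (EllipticGW.merge hn u I)) →
      EllipticGW.TGW q n
          (Function.update u (EllipticGW.first hn) (q * u (EllipticGW.first hn))) =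
        EllipticGW.TGW q n u +
          ∑ I ∈ EllipticGW.subsetsAvoidingFirst hn,
            (-1) ^ I.card * EllipticGW.TGW q (n - I.card) (EllipticGW.merge hn u I) := by
  have h0 : q ≠ 0 := norm_pos_iff.1 hq0
  obtain ⟨t, ht, hne⟩ := EllipticGW.exists_contDen_ne_zero hn hq1
  obtain ⟨N, hN, -⟩ := EllipticGW.exists_isContinuation hn h0 hq1 ht hne
  exact ⟨⟨N, _, hN⟩, fun u hu hu' hI => EllipticGW.TGW_update_mul_q hn h0 hq1 hu hu' hI⟩
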